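/- Let $1<C<\frac32$ be a real number and let $k\ge 3$ and $n\ge \frac{42k}{3-2C}$ be integers. For a family $\mathcal F$ of $k$-element subsets of $[n]=\{1,\dots,n\}$ let $\Delta(\mathcal F)=\max_{x\in[n]}|\{F\in\mathcal F: x\in F\}|$ be its maximum degree and let $\gamma_C(\mathcal F)=|\mathcal F|-C\,\Delta(\mathcal F)$ be its $C$-diversity. Suppose that $\mathcal F\subset\binom{[n]}{k}$ is intersecting, i.e. $F\cap F'\ne\emptyset$ for all $F,F'\in\mathcal F$. Then $$\gamma_C(\mathcal F)\le (3-2C)\binom{n-3}{k-2},$$ and equality holds if and only if $\mathcal F$ is isomorphic to the pure triangle family $\mathcal F_{\triangle}=\{F\in\binom{[n]}{k}: |F\cap\{1,2,3\}|=2\}$, i.e. if and only if some permutation of $[n]$ maps $\mathcal F$ onto $\mathcal F_{\triangle}$. -/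

import Mathlib

/-- The maximum degree `Δ(F) = max_x |F(x)|`, where `F(x) = {S \ {x} : x ∈ S ∈ F}` is
`Finset.memberSubfamily x F` (the maximum over an empty ground set is `0`). -/
def maxDegree {n : ℕ} (F : Finset (Finset (Fin n))) : ℕ :=
  Finset.univ.sup fun x : Fin n => (Finset.memberSubfamily x F).card

/-- The `C`-diversity `γ_C(F) = |F| - C Δ(F)`. -/
noncomputable def cDiversity {n : ℕ} (C : ℝ) (F : Finset (Finset (Fin n))) : ℝ :=
  (F.card : ℝ) - C * (maxDegree F : ℝ)

/-- The pure triangle family: the `k`-subsets of the ground set that contain exactly two of its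
first three elements (`Fin n` is `{0, …, n - 1}`, so these are `0, 1, 2`). -/
def pureTriangle (n k : ℕ) : Finset (Finset (Fin n)) :=
  (Finset.powersetCard k Finset.univ).filter fun S =>
    (S ∩ Finset.univ.filter fun i : Fin n => (i : ℕ) < 3).card = 2

/-- Two families on the ground set `Fin n` are isomorphic if a permutation of the ground set
carries the one onto the other. -/
def FamilyIso {n : ℕ} (F G : Finset (Finset (Fin n))) : Prop :=
  ∃ σ : Equiv.Perm (Fin n), ∀ S : Finset (Fin n), S ∈ F ↔ S.map σ.toEmbedding ∈ G

/-! Write ε = 3 - 2C, N = binom(n-3, k-3) and M = binom(n-3, k-2); the bound on n gives 41N ≤ εM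
(`fortyOne_mul_choose_le`). It suffices that an intersecting F of C-diversity at least εM is a
triangle family, since those have C-diversity exactly εM. As C > 1, every point is avoided by at
least 41N members of such an F.

This forces a triangle. Shift as long as the conditions at hand survive. In a shifted family two
members together overfill some initial segment (`exists_card_initSeg_lt`), so a member that fills at
most half of every segment makes the others dense, and dense members are few by a geometric sum. If
a shift (i, j) breaks a condition instead, few members avoid some small set through i and j.
Shifting on outside that set ends in a shifted family or in a second such set, and either leaves too
few members. Thus fewer than N members avoid some pair x, y (`exists_card_avoid_pair_lt`), and some
z makes the counts for {x, z} and {y, z} add to less than 5N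
(`exists_card_avoid_add_card_avoid_lt`).

All but O(N) members now contain two of x, y, z. Averaging the degrees of these points bounds the
diversity by a weighted count of traces. By Kruskal–Katona (`six_mul_card_traceClass_le`), members
with a smaller trace cost more among the two-point traces than they gain, so every trace has size
two and all such sets are present. -/

/-- The members of `F` that are disjoint from `X`. -/
def avoid {n : ℕ} (F : Finset (Finset (Fin n))) (X : Finset (Fin n)) : Finset (Finset (Fin n)) :=
  F.filter fun S => Disjoint S X

theorem mem_avoid {n : ℕ} {F : Finset (Finset (Fin n))} {X S : Finset (Fin n)} :
    S ∈ avoid F X ↔ S ∈ F ∧ Disjoint S X := by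
  simp [avoid]

/-! ### Shifting, and how it changes the number of members avoiding a set. -/

/-- The effect of the `(i, j)`-shift of the family `F` on the set `S`. -/
def shiftSet {n : ℕ} (F : Finset (Finset (Fin n))) (i j : Fin n) (S : Finset (Fin n)) :
    Finset (Fin n) :=
  if j ∈ S ∧ i ∉ S ∧ insert i (S.erase j) ∉ F then insert i (S.erase j) else S

/-- The `(i, j)`-shift of a family: `j` is replaced by `i` wherever possible. -/
def shiftFamily {n : ℕ} (i j : Fin n) (F : Finset (Finset (Fin n))) : Finset (Finset (Fin n)) :=
  F.image (shiftSet F i j)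

theorem shiftSet_cases {n : ℕ} (F : Finset (Finset (Fin n))) (i j : Fin n) (S : Finset (Fin n)) :
    (j ∈ S ∧ i ∉ S ∧ insert i (S.erase j) ∉ F ∧ shiftSet F i j S = insert i (S.erase j)) ∨
      (¬ (j ∈ S ∧ i ∉ S ∧ insert i (S.erase j) ∉ F) ∧ shiftSet F i j S = S) := by
  unfold shiftSet
  split_ifs with h
  · exact Or.inl ⟨h.1, h.2.1, h.2.2, rfl⟩
  · exact Or.inr ⟨h, rfl⟩

theorem shiftSet_injOn {n : ℕ} (F : Finset (Finset (Fin n))) (i j : Fin n) :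
    Set.InjOn (shiftSet F i j) F := by
  have key : ∀ S : Finset (Fin n), j ∈ S → i ∉ S →
      S = insert j ((insert i (S.erase j)).erase i) := by
    intro S hj hi
    rw [Finset.erase_insert (by simp [hi]), Finset.insert_erase hj]
  intro S hS S' hS' h
  rcases shiftSet_cases F i j S with ⟨h1, h2, h3, h4⟩ | ⟨-, h4⟩ <;>
    rcases shiftSet_cases F i j S' with ⟨g1, g2, g3, g4⟩ | ⟨-, g4⟩ <;> rw [h4, g4] at h
  · rw [key S h1 h2, key S' g1 g2, h]
  · exact absurd (h ▸ hS') h3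
  · exact absurd (h ▸ hS) g3
  · exact h

theorem card_shiftFamily {n : ℕ} (i j : Fin n) (F : Finset (Finset (Fin n))) :
    (shiftFamily i j F).card = F.card :=
  Finset.card_image_of_injOn (shiftSet_injOn F i j)

theorem sized_shiftFamily {n k : ℕ} (i j : Fin n) {F : Finset (Finset (Fin n))}
    (hF : (F : Set (Finset (Fin n))).Sized k) :
    (shiftFamily i j F : Set (Finset (Fin n))).Sized k := by
  intro S₀ hS₀
  obtain ⟨S, hS, rfl⟩ := Finset.mem_image.1 (Finset.mem_coe.1 hS₀)
  rcases shiftSet_cases F i j S with ⟨h1, h2, -, h4⟩ | ⟨-, h4⟩ <;> rw [h4]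
  · rw [Finset.card_insert_of_notMem (by simp [h2]), Finset.card_erase_add_one h1, hF hS]
  · exact hF hS

theorem intersecting_shiftFamily {n : ℕ} (i j : Fin n) {F : Finset (Finset (Fin n))}
    (hF : (F : Set (Finset (Fin n))).Intersecting) :
    (shiftFamily i j F : Set (Finset (Fin n))).Intersecting := by
  have mixed : ∀ S ∈ F, ∀ S' ∈ F, j ∈ S → i ∉ S →
      ¬ (j ∈ S' ∧ i ∉ S' ∧ insert i (S'.erase j) ∉ F) →
      ¬ Disjoint (insert i (S.erase j)) S' := by
    intro S hS S' hS' hj hi hn hd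
    rw [Finset.disjoint_left] at hd
    by_cases hi' : i ∈ S'
    · exact hd (Finset.mem_insert_self _ _) hi'
    by_cases hj' : j ∈ S'
    -- `S'` contains `j` but not `i`, so it stayed only because its image was already in `F`; that
    -- image meets `S`, and not in `i`.
    · have hm : insert i (S'.erase j) ∈ F := by
        by_contra h
        exact hn ⟨hj', hi', h⟩
      obtain ⟨x, hx, hx'⟩ := Finset.not_disjoint_iff.1 (hF hS hm)
      have hxi : x ≠ i := fun h => hi (h ▸ hx)
      have hx2 : x ∈ S'.erase j := by simpa [hxi] using hx'
      rw [Finset.mem_erase] at hx2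
      exact hd (Finset.mem_insert_of_mem (Finset.mem_erase.2 ⟨hx2.1, hx⟩)) hx2.2
    · obtain ⟨x, hx, hx'⟩ := Finset.not_disjoint_iff.1 (hF hS hS')
      have hxj : x ≠ j := fun h => hj' (h ▸ hx')
      exact hd (Finset.mem_insert_of_mem (Finset.mem_erase.2 ⟨hxj, hx⟩)) hx'
  intro S₀ hS₀ S₁ hS₁
  obtain ⟨S, hS, rfl⟩ := Finset.mem_image.1 (Finset.mem_coe.1 hS₀)
  obtain ⟨S', hS', rfl⟩ := Finset.mem_image.1 (Finset.mem_coe.1 hS₁)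
  rcases shiftSet_cases F i j S with ⟨h1, h2, -, h4⟩ | ⟨h3, h4⟩ <;>
    rcases shiftSet_cases F i j S' with ⟨g1, g2, -, g4⟩ | ⟨g3, g4⟩ <;> rw [h4, g4]
  · exact Finset.not_disjoint_iff.2 ⟨i, Finset.mem_insert_self _ _, Finset.mem_insert_self _ _⟩
  · exact mixed S hS S' hS' h1 h2 g3
  · rw [disjoint_comm]
    exact mixed S' hS' S hS g1 g2 h3
  · exact hF hS hS'

theorem card_avoid_shiftFamily {n : ℕ} (i j : Fin n) (F : Finset (Finset (Fin n)))
    (X : Finset (Fin n)) :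
    (avoid (shiftFamily i j F) X).card =
      (F.filter fun S => Disjoint (shiftSet F i j S) X).card := by
  rw [avoid, shiftFamily, Finset.filter_image]
  exact Finset.card_image_of_injOn ((shiftSet_injOn F i j).mono fun S hS => (Finset.mem_filter.1 hS).1)

theorem card_avoid_le_shiftFamily {n : ℕ} {i : Fin n} (j : Fin n) (F : Finset (Finset (Fin n)))
    {X : Finset (Fin n)} (hi : i ∉ X) :
    (avoid F X).card ≤ (avoid (shiftFamily i j F) X).card := by
  rw [card_avoid_shiftFamily]
  refine Finset.card_le_card fun S hS => ?_
  rw [mem_avoid] at hS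
  refine Finset.mem_filter.2 ⟨hS.1, ?_⟩
  rcases shiftSet_cases F i j S with ⟨-, -, -, h4⟩ | ⟨-, h4⟩ <;> rw [h4]
  · rw [Finset.disjoint_insert_left]
    exact ⟨hi, hS.2.mono_left (Finset.erase_subset _ _)⟩
  · exact hS.2

/-- A member without `j` is not moved. So when a shift destroys a lower bound for `avoid _ X`, few
members of the original family avoid `insert j X`. -/
theorem card_avoid_insert_le_shiftFamily {n : ℕ} (i j : Fin n) (F : Finset (Finset (Fin n)))
    (X : Finset (Fin n)) :
    (avoid F (insert j X)).card ≤ (avoid (shiftFamily i j F) X).card := by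
  rw [card_avoid_shiftFamily]
  refine Finset.card_le_card fun S hS => ?_
  rw [mem_avoid, Finset.disjoint_insert_right] at hS
  refine Finset.mem_filter.2 ⟨hS.1, ?_⟩
  rcases shiftSet_cases F i j S with ⟨h1, -⟩ | ⟨-, h4⟩
  · exact absurd h1 hS.2.1
  · rw [h4]
    exact hS.2.2

theorem card_avoid_shiftFamily_eq {n : ℕ} {i j : Fin n} (F : Finset (Finset (Fin n)))
    {X : Finset (Fin n)} (hi : i ∉ X) (hj : j ∉ X) :
    (avoid (shiftFamily i j F) X).card = (avoid F X).card := by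
  refine le_antisymm ?_ (card_avoid_le_shiftFamily j F hi)
  rw [card_avoid_shiftFamily]
  refine Finset.card_le_card fun S hS => ?_
  rw [Finset.mem_filter] at hS
  refine mem_avoid.2 ⟨hS.1, ?_⟩
  have hS2 := hS.2
  rcases shiftSet_cases F i j S with ⟨h1, -, -, h4⟩ | ⟨-, h4⟩ <;> rw [h4] at hS2
  · rw [← Finset.insert_erase h1, Finset.disjoint_insert_left]
    exact ⟨hj, (Finset.disjoint_insert_left.1 hS2).2⟩
  · exact hS2

/-! ### Families stable under shifting inside a set. -/

/-- `F` is closed under replacing an element of `V` by a smaller element of `V`. -/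
def ShiftedOn {n : ℕ} (V : Finset (Fin n)) (F : Finset (Finset (Fin n))) : Prop :=
  ∀ i ∈ V, ∀ j ∈ V, i < j → ∀ S ∈ F, j ∈ S → i ∉ S → insert i (S.erase j) ∈ F

theorem insert_erase_mem_of_shiftFamily_eq {n : ℕ} {i j : Fin n} {F : Finset (Finset (Fin n))}
    (h : shiftFamily i j F = F) {S : Finset (Fin n)} (hS : S ∈ F) (hj : j ∈ S) (hi : i ∉ S) :
    insert i (S.erase j) ∈ F := by
  by_contra hn
  rcases shiftSet_cases F i j S with ⟨-, -, -, h4⟩ | ⟨h3, -⟩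
  · apply hn
    rw [← h4, ← h]
    exact Finset.mem_image.2 ⟨S, hS, by rw [h]⟩
  · exact h3 ⟨hj, hi, hn⟩

theorem sum_insert_erase_lt {n : ℕ} {i j : Fin n} (hij : i < j) {S : Finset (Fin n)} (hj : j ∈ S)
    (hi : i ∉ S) : ∑ x ∈ insert i (S.erase j), (x : ℕ) < ∑ x ∈ S, (x : ℕ) := by
  rw [Finset.sum_insert (by simp [hi]), ← Finset.add_sum_erase S _ hj]
  have : (i : ℕ) < j := hij
  omega

theorem sum_shiftFamily_lt {n : ℕ} {i j : Fin n} (hij : i < j) {F : Finset (Finset (Fin n))}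
    (h : shiftFamily i j F ≠ F) :
    ∑ S ∈ shiftFamily i j F, ∑ x ∈ S, (x : ℕ) < ∑ S ∈ F, ∑ x ∈ S, (x : ℕ) := by
  rw [shiftFamily, Finset.sum_image (shiftSet_injOn F i j)]
  refine Finset.sum_lt_sum (fun S hS => ?_) ?_
  · rcases shiftSet_cases F i j S with ⟨h1, h2, -, h4⟩ | ⟨-, h4⟩ <;> rw [h4]
    exact (sum_insert_erase_lt hij h1 h2).le
  · by_contra! hn
    apply h
    have : ∀ S ∈ F, shiftSet F i j S = S := by
      intro S hS
      rcases shiftSet_cases F i j S with ⟨h1, h2, -, h4⟩ | ⟨-, h4⟩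
      · have := hn S hS
        rw [h4] at this
        exact absurd (sum_insert_erase_lt hij h1 h2) this.not_gt
      · exact h4
    rw [shiftFamily, Finset.image_congr this, Finset.image_id']

/-- A property of families that holds somewhere holds for a family that no shift inside `V`
changes without destroying the property. -/
theorem exists_shift_stable {n : ℕ} (V : Finset (Fin n)) (Good : Finset (Finset (Fin n)) → Prop)
    {F : Finset (Finset (Fin n))} (hF : Good F) :
    ∃ G, Good G ∧ (ShiftedOn V G ∨
      ∃ i ∈ V, ∃ j ∈ V, i < j ∧ ¬ Good (shiftFamily i j G)) := by
  -- The sum of all elements of all members drops with every shift that changes the family.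
  induction hw : ∑ S ∈ F, ∑ x ∈ S, (x : ℕ) using Nat.strong_induction_on generalizing F with
  | _ w ih =>
    by_cases hst : ∀ i ∈ V, ∀ j ∈ V, i < j → Good (shiftFamily i j F) → shiftFamily i j F = F
    · refine ⟨F, hF, ?_⟩
      by_cases hb : ∃ i ∈ V, ∃ j ∈ V, i < j ∧ ¬ Good (shiftFamily i j F)
      · exact Or.inr hb
      · push Not at hb
        exact Or.inl fun i hi j hj hij S hS hjS hiS =>
          insert_erase_mem_of_shiftFamily_eq (hst i hi j hj hij (hb i hi j hj hij)) hS hjS hiS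
    · push Not at hst
      obtain ⟨i, -, j, -, hij, hg, hne⟩ := hst
      exact ih _ (hw ▸ sum_shiftFamily_lt hij hne) hg rfl

/-! ### Initial segments: sparse and dense members. -/

/-- The elements of `V` below `c`. -/
def initSeg {n : ℕ} (V : Finset (Fin n)) (c : ℕ) : Finset (Fin n) :=
  V.filter fun v => (v : ℕ) < c

theorem mem_initSeg {n : ℕ} {V : Finset (Fin n)} {c : ℕ} {v : Fin n} :
    v ∈ initSeg V c ↔ v ∈ V ∧ (v : ℕ) < c := by
  simp [initSeg]

/-- Two members of a shifted intersecting family that do not meet outside `V` together overfill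
some initial segment of `V`. -/
theorem exists_card_initSeg_lt {n : ℕ} {V : Finset (Fin n)} {F : Finset (Finset (Fin n))}
    (hs : ShiftedOn V F) (hI : (F : Set (Finset (Fin n))).Intersecting) {A B : Finset (Fin n)}
    (hA : A ∈ F) (hB : B ∈ F) (hAB : ∀ x ∈ A, x ∈ B → x ∈ V) :
    ∃ c, (initSeg V c).card < (A ∩ initSeg V c).card + (B ∩ initSeg V c).card := by
  induction hw : ∑ x ∈ B, (x : ℕ) using Nat.strong_induction_on generalizing B with
  | _ w ih =>
    by_contra! hc
    have hne : (A ∩ B).Nonempty := Finset.not_disjoint_iff_nonempty_inter.1 (hI hA hB)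
    obtain ⟨j, hj, hmin⟩ := (A ∩ B).exists_min_image id hne
    rw [Finset.mem_inter] at hj
    have hjV := hAB j hj.1 hj.2
    have hjseg : j ∈ initSeg V (j + 1) := mem_initSeg.2 ⟨hjV, by omega⟩
    -- Otherwise `A ∪ B` covers the segment ending at `j` and counts `j` twice, so that segment is
    -- overfilled.
    obtain ⟨i, hi, hi'⟩ : ∃ i ∈ initSeg V (j + 1), i ∉ A ∪ B := by
      by_contra! hcov
      have h1 := Finset.card_union_add_card_inter (A ∩ initSeg V (j + 1)) (B ∩ initSeg V (j + 1))
      have h2 : initSeg V (j + 1) ⊆ (A ∩ initSeg V (j + 1)) ∪ (B ∩ initSeg V (j + 1)) := by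
        intro x hx
        have := hcov x hx
        simp only [Finset.mem_union, Finset.mem_inter] at this ⊢
        tauto
      have h3 : 0 < ((A ∩ initSeg V (j + 1)) ∩ (B ∩ initSeg V (j + 1))).card :=
        Finset.card_pos.2 ⟨j, by simp [hj.1, hj.2, hjseg]⟩
      have := Finset.card_le_card h2
      have := hc (j + 1)
      omega
    rw [mem_initSeg] at hi
    rw [Finset.mem_union, not_or] at hi'
    have hij : i < j := by
      have h1 : i ≠ j := fun h => hi'.1 (h ▸ hj.1)
      have h2 : (i : ℕ) ≤ j := by omega
      exact lt_of_le_of_ne h2 h1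
    have hB' := hs i hi.1 j hjV hij B hB hj.2 hi'.2
    obtain ⟨c, hc'⟩ := ih _ (hw ▸ sum_insert_erase_lt hij hj.2 hi'.2) hB' (by
      intro x hxA hx
      rcases Finset.mem_insert.1 hx with rfl | hx
      · exact hi.1
      · exact hAB x hxA (Finset.mem_of_mem_erase hx)) rfl
    refine absurd hc' (not_lt.2 ?_)
    -- In segments containing `j`, exchanging `j` for `i` gains nothing; in those below `j`, `A` and
    -- the new `B` are disjoint. Neither kind can be overfilled.
    by_cases hcj : (j : ℕ) < c
    · refine le_trans (Nat.add_le_add_left ?_ _) (hc c)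
      have hjm : j ∈ B ∩ initSeg V c := by simp [hj.2, mem_initSeg, hjV, hcj]
      calc (insert i (B.erase j) ∩ initSeg V c).card
          ≤ (insert i ((B ∩ initSeg V c).erase j)).card := by
            refine Finset.card_le_card fun x hx => ?_
            simp only [Finset.mem_inter, Finset.mem_insert, Finset.mem_erase] at hx ⊢
            tauto
        _ ≤ ((B ∩ initSeg V c).erase j).card + 1 := Finset.card_insert_le _ _
        _ = (B ∩ initSeg V c).card := Finset.card_erase_add_one hjm
    · rw [← Finset.card_union_of_disjoint]
      · exact Finset.card_le_card (Finset.union_subset Finset.inter_subset_right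
          Finset.inter_subset_right)
      · rw [Finset.disjoint_left]
        intro x hx hx'
        simp only [Finset.mem_inter, Finset.mem_insert, Finset.mem_erase, mem_initSeg] at hx hx'
        rcases hx'.1 with rfl | hxB
        · exact hi'.1 hx.1
        · have := hmin x (Finset.mem_inter.2 ⟨hx.1, hxB.2⟩)
          have : (j : ℕ) ≤ x := this
          omega

/-- `A` fills at most half of each initial segment of `V`. -/
def SparseOn {n : ℕ} (V A : Finset (Fin n)) : Prop :=
  ∀ c, 2 * (A ∩ initSeg V c).card ≤ (initSeg V c).card

/-- `B` exceeds half of some initial segment of `V` by at least one. -/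
def DenseOn {n : ℕ} (V B : Finset (Fin n)) : Prop :=
  ∃ c, (initSeg V c).card + 2 ≤ 2 * (B ∩ initSeg V c).card

theorem denseOn_of_sparseOn {n : ℕ} {V : Finset (Fin n)} {F : Finset (Finset (Fin n))}
    (hs : ShiftedOn V F) (hI : (F : Set (Finset (Fin n))).Intersecting) {A B : Finset (Fin n)}
    (hA : A ∈ F) (hB : B ∈ F) (hAB : ∀ x ∈ A, x ∈ B → x ∈ V) (hsp : SparseOn V A) :
    DenseOn V B := by
  obtain ⟨c, hc⟩ := exists_card_initSeg_lt hs hI hA hB hAB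
  have := hsp c
  exact ⟨c, by omega⟩

/-- Dropping the least element `z`, which `A` misses, shortens the segment by one and turns "more
than half" into the excess that `DenseOn` asks for. -/
theorem denseOn_erase_of_not_sparseOn {n : ℕ} {V A : Finset (Fin n)} {z : Fin n} (hz : z ∈ V)
    (hmin : ∀ v ∈ V, z ≤ v) (hzA : z ∉ A) (h : ¬ SparseOn V A) : DenseOn (V.erase z) A := by
  rw [SparseOn] at h
  push Not at h
  obtain ⟨c, hc⟩ := h
  have hpos : 0 < (A ∩ initSeg V c).card := by omega
  obtain ⟨x, hx⟩ := Finset.card_pos.1 hpos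
  rw [Finset.mem_inter, mem_initSeg] at hx
  have hzc : z ∈ initSeg V c := by
    have : (z : ℕ) ≤ x := hmin x hx.2.1
    exact mem_initSeg.2 ⟨hz, by omega⟩
  have h1 : initSeg (V.erase z) c = (initSeg V c).erase z := by
    ext v
    simp only [mem_initSeg, Finset.mem_erase]
    tauto
  have h2 : A ∩ (initSeg V c).erase z = A ∩ initSeg V c := by
    ext v
    simp only [Finset.mem_inter, Finset.mem_erase]
    constructor
    · tauto
    · rintro ⟨hv, hv'⟩
      exact ⟨hv, fun h => hzA (h ▸ hv), hv'⟩
  have h3 := Finset.card_erase_add_one hzc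
  exact ⟨c, by rw [h1, h2]; omega⟩

/-! ### Counting dense members by a geometric sum. -/

/-- The first `l` elements of `V`. -/
def firstElems {n : ℕ} (V : Finset (Fin n)) (l : ℕ) : Finset (Fin n) :=
  V.filter fun v => (V.filter fun w => w < v).card < l

theorem firstElems_subset {n : ℕ} (V : Finset (Fin n)) (l : ℕ) : firstElems V l ⊆ V :=
  Finset.filter_subset _ _

theorem card_firstElems_le {n : ℕ} (V : Finset (Fin n)) (l : ℕ) : (firstElems V l).card ≤ l := by
  have hlt : ∀ v ∈ V, ∀ w, v < w →
      (V.filter fun u => u < v).card < (V.filter fun u => u < w).card := by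
    intro v hv w hvw
    refine Finset.card_lt_card (Finset.ssubset_iff_of_subset ?_ |>.2 ⟨v, by simp [hv, hvw], by simp⟩)
    intro u hu
    rw [Finset.mem_filter] at hu ⊢
    exact ⟨hu.1, hu.2.trans hvw⟩
  have := Finset.card_le_card_of_injOn (s := firstElems V l) (t := Finset.range l)
    (fun v => (V.filter fun w => w < v).card)
    (fun v hv => by simpa using (Finset.mem_filter.1 hv).2) (by
      intro v hv w hw h
      have hv := firstElems_subset _ _ hv
      have hw := firstElems_subset _ _ hw
      rcases lt_trichotomy v w with h1 | h1 | h1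
      · exact absurd h (hlt v hv w h1).ne
      · exact h1
      · exact absurd h (hlt w hw v h1).ne')
  simpa using this

theorem initSeg_subset_firstElems {n : ℕ} (V : Finset (Fin n)) (c : ℕ) {l : ℕ}
    (hl : (initSeg V c).card ≤ l) : initSeg V c ⊆ firstElems V l := by
  intro v hv
  refine Finset.mem_filter.2 ⟨(mem_initSeg.1 hv).1, lt_of_lt_of_le (Finset.card_lt_card ?_) hl⟩
  refine Finset.ssubset_iff_of_subset ?_ |>.2 ⟨v, hv, by simp⟩
  intro u hu
  rw [Finset.mem_filter] at hu
  have h1 : (u : ℕ) < v := hu.2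
  have h2 := (mem_initSeg.1 hv).2
  exact mem_initSeg.2 ⟨hu.1, by omega⟩

theorem DenseOn.exists_card_inter {n : ℕ} {V S : Finset (Fin n)} (h : DenseOn V S) :
    ∃ m, 1 ≤ m ∧ m + 1 ≤ (S ∩ firstElems V (2 * m)).card := by
  obtain ⟨c, hc⟩ := h
  have hle : (S ∩ initSeg V c).card ≤ (initSeg V c).card :=
    Finset.card_le_card Finset.inter_subset_right
  -- `2 * m` is the segment length rounded up to an even number; the excess in `DenseOn` survives
  -- the rounding.
  refine ⟨((initSeg V c).card + 1) / 2, by omega, ?_⟩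
  have := Finset.card_le_card (Finset.inter_subset_inter (Finset.Subset.refl S)
    (initSeg_subset_firstElems V c (l := 2 * (((initSeg V c).card + 1) / 2)) (by omega)))
  omega

theorem card_filter_superset_le {n k : ℕ} {F : Finset (Finset (Fin n))}
    (hF : (F : Set (Finset (Fin n))).Sized k) (W : Finset (Fin n)) :
    (F.filter fun S => W ⊆ S).card ≤ (n - W.card).choose (k - W.card) := by
  calc (F.filter fun S => W ⊆ S).card
      ≤ (Finset.powersetCard (k - W.card) Wᶜ).card := by
        refine Finset.card_le_card_of_injOn (fun S => S \ W) (fun S hS => ?_) ?_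
        · have hS := Finset.mem_filter.1 hS
          refine Finset.mem_coe.2 (Finset.mem_powersetCard.2 ⟨fun x hx => ?_, ?_⟩)
          · simpa using (Finset.mem_sdiff.1 hx).2
          · rw [Finset.card_sdiff_of_subset hS.2, hF hS.1]
        · intro S hS S' hS' h
          have hS := (Finset.mem_filter.1 hS).2
          have hS' := (Finset.mem_filter.1 hS').2
          rw [← Finset.sdiff_union_of_subset hS, ← Finset.sdiff_union_of_subset hS']
          exact congrArg (· ∪ W) h
    _ = _ := by rw [Finset.card_powersetCard, Finset.card_compl, Fintype.card_fin]

theorem card_filter_card_inter_le {n k m : ℕ} {F : Finset (Finset (Fin n))}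
    (hF : (F : Set (Finset (Fin n))).Sized k) {Q P : Finset (Fin n)} (hQP : Disjoint Q P)
    (hP : P.card ≤ 2 * m) :
    (F.filter fun S => Q ⊆ S ∧ m + 1 ≤ (S ∩ P).card).card ≤
      (2 * m).choose (m + 1) * (n - (Q.card + m + 1)).choose (k - (Q.card + m + 1)) := by
  calc (F.filter fun S => Q ⊆ S ∧ m + 1 ≤ (S ∩ P).card).card
      ≤ ((Finset.powersetCard (m + 1) P).biUnion fun U => F.filter fun S => Q ∪ U ⊆ S).card := by
        refine Finset.card_le_card fun S hS => ?_
        rw [Finset.mem_filter] at hS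
        obtain ⟨U, hU, hUc⟩ := Finset.exists_subset_card_eq hS.2.2
        rw [Finset.subset_inter_iff] at hU
        exact Finset.mem_biUnion.2 ⟨U, Finset.mem_powersetCard.2 ⟨hU.2, hUc⟩,
          Finset.mem_filter.2 ⟨hS.1, Finset.union_subset hS.2.1 hU.1⟩⟩
    _ ≤ ∑ U ∈ Finset.powersetCard (m + 1) P,
          (n - (Q.card + m + 1)).choose (k - (Q.card + m + 1)) := by
        refine Finset.card_biUnion_le.trans (Finset.sum_le_sum fun U hU => ?_)
        rw [Finset.mem_powersetCard] at hU
        have := card_filter_superset_le hF (Q ∪ U)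
        rwa [Finset.card_union_of_disjoint (hQP.mono_right hU.1), hU.2, ← add_assoc] at this
    _ ≤ _ := by
        rw [Finset.sum_const, Finset.card_powersetCard, smul_eq_mul]
        exact Nat.mul_le_mul_right _ (Nat.choose_le_choose _ hP)

/-- Pascal's rule, used twice, writes the next binomial as `a + 2 * b + d`, where `b` is the current
one and `a`, `d` are its neighbours. Since `a + d ≤ 2 * b`, the growth factor is at most 4. -/
theorem choose_two_mul_succ_le {m : ℕ} (hm : 1 ≤ m) : (2 * m).choose (m + 1) ≤ 4 ^ (m - 1) := by
  induction m, hm using Nat.le_induction with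
  | base => decide
  | succ m hm ih =>
    have e1 : (2 * (m + 1)).choose (m + 1 + 1) =
        (2 * m).choose m + 2 * (2 * m).choose (m + 1) + (2 * m).choose (m + 2) := by
      rw [show 2 * (m + 1) = 2 * m + 1 + 1 by ring, Nat.choose_succ_succ, Nat.choose_succ_succ,
        Nat.choose_succ_succ (2 * m) (m + 1)]
      ring
    have e2 := Nat.choose_succ_right_eq (2 * m) m
    have e3 := Nat.choose_succ_right_eq (2 * m) (m + 1)
    rw [show 2 * m - m = m by omega] at e2
    rw [show 2 * m - (m + 1) = m - 1 by omega] at e3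
    have hp : 4 ^ (m + 1 - 1) = 4 * 4 ^ (m - 1) := by
      rw [← pow_succ', show m - 1 + 1 = m + 1 - 1 by omega]
    rw [e1, hp]
    have key : (2 * m).choose m + (2 * m).choose (m + 2) ≤ 2 * (2 * m).choose (m + 1) := by
      obtain ⟨l, rfl⟩ : ∃ l, m = l + 1 := ⟨m - 1, by omega⟩
      simp only [Nat.add_sub_cancel] at e3
      set a := (2 * (l + 1)).choose (l + 1)
      set b := (2 * (l + 1)).choose (l + 1 + 1)
      set d := (2 * (l + 1)).choose (l + 1 + 2)
      have e3 : d * (l + 3) = b * l := e3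
      have h : (a + d) * ((l + 1) * (l + 3)) ≤ 2 * b * ((l + 1) * (l + 3)) := by
        calc (a + d) * ((l + 1) * (l + 3)) = (a * (l + 1)) * (l + 3) + (d * (l + 3)) * (l + 1) := by
              ring
          _ = b * (l + 1 + 1) * (l + 3) + b * l * (l + 1) := by rw [← e2, e3]
          _ ≤ _ := by nlinarith [Nat.zero_le (b * l)]
      exact Nat.le_of_mul_le_mul_right h (by positivity)
    omega

/-- The two binomials have ratio `a / b`. The value 40 offsets the growth factor 4 of
`choose_two_mul_succ_le` and leaves a geometric ratio of 1/10. -/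
theorem forty_mul_choose_le {a b : ℕ} (hb : 1 ≤ b) (hab : 40 * b ≤ a) :
    40 * (a - 1).choose (b - 1) ≤ a.choose b := by
  obtain ⟨b, rfl⟩ : ∃ b', b = b' + 1 := ⟨b - 1, by omega⟩
  obtain ⟨a, rfl⟩ : ∃ a', a = a' + 1 := ⟨a - 1, by omega⟩
  simp only [Nat.add_sub_cancel]
  have h := Nat.add_one_mul_choose_eq a b
  refine Nat.le_of_mul_le_mul_right (c := b + 1) ?_ (by omega)
  rw [← h]
  calc 40 * a.choose b * (b + 1) = (40 * (b + 1)) * a.choose b := by ring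
    _ ≤ _ := Nat.mul_le_mul_right _ hab

theorem nine_mul_sum_le {g : ℕ → ℕ} {l M : ℕ} (hlM : l ≤ M)
    (hg : ∀ m, l ≤ m → m < M → 10 * g (m + 1) ≤ g m) :
    9 * ∑ m ∈ Finset.Icc l M, g m ≤ 10 * g l := by
  -- The extra `g M` lets the induction close: a new term adds `10 * g (M + 1)` in all, which the
  -- old `g M` pays for.
  suffices h : 9 * ∑ m ∈ Finset.Icc l M, g m + g M ≤ 10 * g l by omega
  induction M, hlM using Nat.le_induction with
  | base => simp; omega
  | succ M hlM ih =>
    have h1 := ih fun m h h' => hg m h (by omega)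
    have h2 := hg M hlM (by omega)
    rw [Finset.sum_Icc_succ_top (by omega)]
    omega

/-- The number of members of a `k`-uniform family that contain `Q` and are dense in `V` beyond the
first `2 * l - 1` places. -/
theorem nine_mul_card_le_of_exists_card_inter {n k l : ℕ} (hn : 42 * k ≤ n) {F : Finset (Finset (Fin n))}
    (hF : (F : Set (Finset (Fin n))).Sized k) {Q V : Finset (Fin n)} (hQV : Disjoint Q V)
    (hl : 1 ≤ l)
    (h : ∀ S ∈ F, Q ⊆ S ∧ ∃ m, l ≤ m ∧ m + 1 ≤ (S ∩ firstElems V (2 * m)).card) :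
    9 * F.card ≤
      10 * (4 ^ (l - 1) * (n - (Q.card + l + 1)).choose (k - (Q.card + l + 1))) := by
  have hQP : ∀ m, Disjoint Q (firstElems V (2 * m)) := fun m =>
    hQV.mono_right (firstElems_subset _ _)
  have hbd : ∀ S ∈ F, ∀ m, Q ⊆ S → m + 1 ≤ (S ∩ firstElems V (2 * m)).card →
      Q.card + m + 1 ≤ k := by
    intro S hS m hQ hm
    have h1 : Q ∪ (S ∩ firstElems V (2 * m)) ⊆ S :=
      Finset.union_subset hQ Finset.inter_subset_left
    have h2 := Finset.card_le_card h1
    rw [Finset.card_union_of_disjoint ((hQP m).mono_right Finset.inter_subset_right), hF hS] at h2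
    omega
  by_cases hk : Q.card + l + 1 ≤ k
  · have hlM : l ≤ k - Q.card - 1 := by omega
    refine le_trans (Nat.mul_le_mul_left 9 ?_) (nine_mul_sum_le (g := fun m => 4 ^ (m - 1) *
      (n - (Q.card + m + 1)).choose (k - (Q.card + m + 1))) hlM ?_)
    · calc _ ≤ ((Finset.Icc l (k - Q.card - 1)).biUnion fun m =>
              F.filter fun S => Q ⊆ S ∧ m + 1 ≤ (S ∩ firstElems V (2 * m)).card).card := by
            refine Finset.card_le_card fun S hS => ?_
            obtain ⟨hQ, m, hm, hmc⟩ := h S hS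
            have := hbd S hS m hQ hmc
            exact Finset.mem_biUnion.2 ⟨m, Finset.mem_Icc.2 ⟨hm, by omega⟩,
              Finset.mem_filter.2 ⟨hS, hQ, hmc⟩⟩
        _ ≤ _ := by
            refine Finset.card_biUnion_le.trans (Finset.sum_le_sum fun m hm => ?_)
            rw [Finset.mem_Icc] at hm
            exact (card_filter_card_inter_le hF (hQP m) (card_firstElems_le _ _)).trans
              (Nat.mul_le_mul_right _ (choose_two_mul_succ_le (by omega)))
    · intro m hm hmM
      have := forty_mul_choose_le (a := n - (Q.card + m + 1)) (b := k - (Q.card + m + 1))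
        (by omega) (by omega)
      rw [show n - (Q.card + m + 1) - 1 = n - (Q.card + (m + 1) + 1) by omega,
        show k - (Q.card + m + 1) - 1 = k - (Q.card + (m + 1) + 1) by omega] at this
      have hp : 4 ^ (m + 1 - 1) = 4 * 4 ^ (m - 1) := by
        rw [← pow_succ', show m - 1 + 1 = m + 1 - 1 by omega]
      calc 10 * (4 ^ (m + 1 - 1) * (n - (Q.card + (m + 1) + 1)).choose (k - (Q.card + (m + 1) + 1)))
          = 4 ^ (m - 1) * (40 * (n - (Q.card + (m + 1) + 1)).choose
              (k - (Q.card + (m + 1) + 1))) := by rw [hp]; ring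
        _ ≤ _ := Nat.mul_le_mul_left _ this
  -- A member would need at least `Q.card + l + 1 > k` elements, so `F` is empty.
  · rw [Finset.eq_empty_of_forall_notMem (s := F)]
    · simp
    · intro S hS
      obtain ⟨hQ, m, hm, hmc⟩ := h S hS
      have := hbd S hS m hQ hmc
      omega

theorem nine_mul_card_le_of_mem_of_denseOn {n k : ℕ} (hn : 42 * k ≤ n)
    {F : Finset (Finset (Fin n))} (hF : (F : Set (Finset (Fin n))).Sized k) {V : Finset (Fin n)}
    {x : Fin n} (hx : x ∉ V) (h : ∀ S ∈ F, x ∈ S ∧ DenseOn V S) :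
    9 * F.card ≤ 10 * (n - 3).choose (k - 3) := by
  have := nine_mul_card_le_of_exists_card_inter hn hF (Q := {x}) (V := V)
    (Finset.disjoint_singleton_left.2 hx) le_rfl
    fun S hS => ⟨Finset.singleton_subset_iff.2 (h S hS).1, (h S hS).2.exists_card_inter⟩
  simpa using this

/-- If every pair of points has codegree at most `D`, then few members are dense in `V`. -/
theorem nine_mul_card_le_of_codegree_of_denseOn {n k D : ℕ} (hn : 42 * k ≤ n)
    {F : Finset (Finset (Fin n))} (hF : (F : Set (Finset (Fin n))).Sized k) {V : Finset (Fin n)}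
    (hD : ∀ x y, x ≠ y → (F.filter fun S => x ∈ S ∧ y ∈ S).card ≤ D)
    (h : ∀ S ∈ F, DenseOn V S) :
    9 * F.card ≤ 9 * D + 40 * (n - 3).choose (k - 3) := by
  -- Density at `m = 1` puts the first two elements of `V` into `S`, which the codegree bounds; `m ≥
  -- 2` is left to the geometric sum, whose first term carries the factor 4.
  have h2 : (F.filter fun S => 2 ≤ (S ∩ firstElems V 2).card).card ≤ D := by
    by_cases hc : (firstElems V 2).card = 2
    · obtain ⟨x, y, hxy, he⟩ := Finset.card_eq_two.1 hc
      refine le_trans (Finset.card_le_card fun S hS => ?_) (hD x y hxy)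
      rw [Finset.mem_filter] at hS ⊢
      have h3 : S ∩ firstElems V 2 = firstElems V 2 :=
        Finset.eq_of_subset_of_card_le Finset.inter_subset_right (by omega)
      rw [Finset.inter_eq_right, he] at h3
      exact ⟨hS.1, h3 (by simp), h3 (by simp)⟩
    · rw [Finset.filter_eq_empty_iff.2]
      · simp
      · intro S hS h3
        have h4 := card_firstElems_le V 2
        have h5 : (S ∩ firstElems V 2).card ≤ (firstElems V 2).card :=
          Finset.card_le_card Finset.inter_subset_right
        omega
  have h1 := nine_mul_card_le_of_exists_card_inter hn
    (F := F.filter fun S => ¬ 2 ≤ (S ∩ firstElems V 2).card)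
    (hF.mono fun S hS => (Finset.mem_filter.1 hS).1) (Q := ∅) (V := V) (l := 2)
    (Finset.disjoint_empty_left _) (by norm_num) (by
      intro S hS
      rw [Finset.mem_filter] at hS
      obtain ⟨m, hm, hmc⟩ := (h S hS.1).exists_card_inter
      refine ⟨Finset.empty_subset _, m, ?_, hmc⟩
      rcases hm.eq_or_lt with rfl | hm
      · exact absurd hmc hS.2
      · exact hm)
  have h3 := Finset.card_filter_add_card_filter_not (s := F)
    (fun S => 2 ≤ (S ∩ firstElems V 2).card)
  simp only [Finset.card_empty, zero_add, Nat.reduceAdd, Nat.reduceSub, pow_one] at h1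
  omega

/-! ### Cross-intersecting trace classes and codegrees. -/

open scoped FinsetFamily in
/-- Cross-intersecting families: if `ℬ` is at least as large as the family of all `b`-sets that
contain `t` given points, then `𝒜` is at most as large as the family of all `a`-sets that meet
`t` given points. -/
theorem card_add_choose_le_of_cross {n a b t : ℕ} {V : Finset (Fin n)}
    {𝒜 ℬ : Finset (Finset (Fin n))} (h𝒜V : ∀ A ∈ 𝒜, A ⊆ V) (hℬV : ∀ B ∈ ℬ, B ⊆ V)
    (h𝒜 : (𝒜 : Set (Finset (Fin n))).Sized a) (hℬ : (ℬ : Set (Finset (Fin n))).Sized b)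
    (hcross : ∀ A ∈ 𝒜, ∀ B ∈ ℬ, ¬ Disjoint A B) (htb : t ≤ b) (hab : a + b ≤ V.card)
    (hcard : (V.card - t).choose (b - t) ≤ ℬ.card) :
    𝒜.card + (V.card - t).choose a ≤ V.card.choose a := by
  set m := V.card with hm
  have hmn : m ≤ n := by simpa using Finset.card_le_univ V
  -- An `a`-set inside some `V \ B` misses `B`, hence is not in `𝒜`; Kruskal–Katona bounds the
  -- number of these sets from below.
  set ℬ' := ℬ.image fun B => V \ B with hℬ'
  have hcard' : ℬ'.card = ℬ.card := by
    refine Finset.card_image_of_injOn fun B hB B' hB' h => ?_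
    have h : V \ B = V \ B' := h
    rw [← Finset.sdiff_sdiff_eq_self (hℬV B hB), h, Finset.sdiff_sdiff_eq_self (hℬV B' hB')]
  have hsz : (ℬ' : Set (Finset (Fin n))).Sized (m - b) := by
    intro X hX
    obtain ⟨B, hB, rfl⟩ := Finset.mem_image.1 (Finset.mem_coe.1 hX)
    rw [Finset.card_sdiff_of_subset (hℬV B hB), hℬ hB]
  have hch : (m - t).choose (m - b) ≤ ℬ'.card := by
    rw [hcard', Nat.choose_symm_of_eq_add (b := b - t) (by omega)]
    exact hcard
  have hkk := Finset.kruskal_katona_lovasz_form (i := m - b - a) (by omega) (by omega) (by omega)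
    hsz hch
  rw [show m - b - (m - b - a) = a by omega] at hkk
  have hsub : (∂^[m - b - a] ℬ') ⊆ Finset.powersetCard a V \ 𝒜 := by
    intro X hX
    obtain ⟨Y, hY, hXY, hc⟩ := Finset.mem_shadow_iterate_iff_exists_sdiff.1 hX
    have hYc := hsz (Finset.mem_coe.2 hY)
    obtain ⟨B, hB, rfl⟩ := Finset.mem_image.1 hY
    have h1 := Finset.card_sdiff_of_subset hXY
    have h2 := Finset.card_le_card hXY
    rw [Finset.mem_sdiff, Finset.mem_powersetCard]
    refine ⟨⟨hXY.trans Finset.sdiff_subset, by omega⟩, fun hXA => hcross X hXA B hB ?_⟩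
    exact Finset.disjoint_of_subset_left hXY Finset.sdiff_disjoint
  have h1 := Finset.card_le_card hsub
  have h2 : 𝒜 ⊆ Finset.powersetCard a V := fun A hA =>
    Finset.mem_powersetCard.2 ⟨h𝒜V A hA, h𝒜 hA⟩
  have h3 := Finset.card_le_card h2
  rw [Finset.card_sdiff_of_subset h2] at h1
  rw [Finset.card_powersetCard, ← hm] at h1 h3
  omega

/-- The members of `F` whose trace on `T` is `U`. -/
def traceClass {n : ℕ} (F : Finset (Finset (Fin n))) (T U : Finset (Fin n)) :
    Finset (Finset (Fin n)) :=
  F.filter fun S => S ∩ T = U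

theorem mem_traceClass {n : ℕ} {F : Finset (Finset (Fin n))} {T U S : Finset (Fin n)} :
    S ∈ traceClass F T U ↔ S ∈ F ∧ S ∩ T = U := by
  simp [traceClass]

theorem card_image_sdiff_traceClass {n : ℕ} (F : Finset (Finset (Fin n))) (T U : Finset (Fin n)) :
    ((traceClass F T U).image fun S => S \ T).card = (traceClass F T U).card := by
  refine Finset.card_image_of_injOn fun S hS S' hS' h => ?_
  have h : S \ T = S' \ T := h
  rw [← Finset.sdiff_union_inter S T, ← Finset.sdiff_union_inter S' T, h,
    (mem_traceClass.1 hS).2, (mem_traceClass.1 hS').2]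

theorem sized_image_sdiff_traceClass {n k : ℕ} {F : Finset (Finset (Fin n))}
    (hF : (F : Set (Finset (Fin n))).Sized k) (T U : Finset (Fin n)) :
    (((traceClass F T U).image fun S => S \ T : Finset (Finset (Fin n))) :
      Set (Finset (Fin n))).Sized (k - U.card) := by
  intro X hX
  obtain ⟨S, hS, rfl⟩ := Finset.mem_image.1 (Finset.mem_coe.1 hX)
  rw [mem_traceClass] at hS
  have := Finset.card_sdiff_add_card_inter S T
  rw [hS.2, hF hS.1] at this
  omega

theorem card_traceClass_add_choose_le {n k t : ℕ} {F : Finset (Finset (Fin n))}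
    (hF : (F : Set (Finset (Fin n))).Sized k) (hI : (F : Set (Finset (Fin n))).Intersecting)
    {T U U' : Finset (Fin n)} (hUU' : Disjoint U U') (ht : t + U'.card ≤ k)
    (hn : 2 * k + T.card ≤ n)
    (hcard : (n - T.card - t).choose (k - U'.card - t) ≤ (traceClass F T U').card) :
    (traceClass F T U).card + (n - T.card - t).choose (k - U.card) ≤
      (n - T.card).choose (k - U.card) := by
  have hV : Tᶜ.card = n - T.card := by rw [Finset.card_compl, Fintype.card_fin]
  have := card_add_choose_le_of_cross (V := Tᶜ) (t := t)
    (𝒜 := (traceClass F T U).image fun S => S \ T) (ℬ := (traceClass F T U').image fun S => S \ T)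
    (a := k - U.card) (b := k - U'.card) ?_ ?_ (sized_image_sdiff_traceClass hF T U)
    (sized_image_sdiff_traceClass hF T U') ?_ (by omega) (by rw [hV]; omega) ?_
  · rwa [hV, card_image_sdiff_traceClass] at this
  · intro A hA
    obtain ⟨S, -, rfl⟩ := Finset.mem_image.1 hA
    intro x hx
    simpa using (Finset.mem_sdiff.1 hx).2
  · intro A hA
    obtain ⟨S, -, rfl⟩ := Finset.mem_image.1 hA
    intro x hx
    simpa using (Finset.mem_sdiff.1 hx).2
  · intro A hA B hB hd
    obtain ⟨S, hS, rfl⟩ := Finset.mem_image.1 hA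
    obtain ⟨S', hS', rfl⟩ := Finset.mem_image.1 hB
    rw [mem_traceClass] at hS hS'
    obtain ⟨x, hx, hx'⟩ := Finset.not_disjoint_iff.1 (hI hS.1 hS'.1)
    rw [Finset.disjoint_left] at hd hUU'
    by_cases hxT : x ∈ T
    · exact hUU' (hS.2 ▸ Finset.mem_inter.2 ⟨hx, hxT⟩) (hS'.2 ▸ Finset.mem_inter.2 ⟨hx', hxT⟩)
    · exact hd (Finset.mem_sdiff.2 ⟨hx, hxT⟩) (Finset.mem_sdiff.2 ⟨hx', hxT⟩)
  · rwa [hV, card_image_sdiff_traceClass]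

theorem avoid_eq_traceClass {n : ℕ} (F : Finset (Finset (Fin n))) (T : Finset (Fin n)) :
    avoid F T = traceClass F T ∅ := by
  ext S
  rw [mem_avoid, mem_traceClass, Finset.disjoint_iff_inter_eq_empty]

theorem choose_le_choose_sub_three_add {m r : ℕ} (hm : 3 ≤ m) :
    m.choose (r + 1) ≤ (m - 3).choose (r + 1) + 3 * (m - 1).choose r := by
  obtain ⟨m, rfl⟩ : ∃ l, m = l + 3 := ⟨m - 3, by omega⟩
  have h1 := Nat.choose_succ_succ (m + 2) r
  have h2 := Nat.choose_succ_succ (m + 1) r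
  have h3 := Nat.choose_succ_succ m r
  have h4 := Nat.choose_le_choose r (show m ≤ m + 2 by omega)
  have h5 := Nat.choose_le_choose r (show m + 1 ≤ m + 2 by omega)
  simp only [Nat.add_sub_cancel, show m + 3 - 1 = m + 2 by omega, Nat.succ_eq_add_one,
    show m + 2 + 1 = m + 3 by rfl, show m + 1 + 1 = m + 2 by rfl] at *
  omega

/-- If many members of an intersecting family avoid a pair of points, then the pair has small
codegree. -/
theorem card_filter_mem_mem_le {n k : ℕ} (hk : 3 ≤ k) (hn : 42 * k ≤ n)
    {F : Finset (Finset (Fin n))} (hF : (F : Set (Finset (Fin n))).Sized k)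
    (hI : (F : Set (Finset (Fin n))).Intersecting) {x y : Fin n} (hxy : x ≠ y)
    (h : (n - 3).choose (k - 3) ≤ (avoid F {x, y}).card) :
    (F.filter fun S => x ∈ S ∧ y ∈ S).card ≤ 3 * (n - 3).choose (k - 3) := by
  have hT : ({x, y} : Finset (Fin n)).card = 2 := Finset.card_pair hxy
  have hc : (n - 2 - 3).choose (k - 0 - 3) ≤ (n - 3).choose (k - 3) :=
    Nat.choose_le_choose _ (by omega)
  -- With `t = 3`, the members through the pair fall short of `(n - 2).choose (k - 2)` by at least
  -- `(n - 5).choose (k - 2)`.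
  have := card_traceClass_add_choose_le hF hI (T := {x, y}) (U := {x, y}) (U' := ∅) (t := 3)
    (Finset.disjoint_empty_right _) (by simpa using hk) (by omega)
    (by rw [hT, ← avoid_eq_traceClass]; simpa using hc.trans h)
  rw [hT] at this
  have h2 := choose_le_choose_sub_three_add (m := n - 2) (r := k - 3) (by omega)
  rw [show k - 3 + 1 = k - 2 by omega, show n - 2 - 1 = n - 3 by omega] at h2
  have h3 : (F.filter fun S => x ∈ S ∧ y ∈ S) = traceClass F {x, y} {x, y} := by
    ext S
    rw [Finset.mem_filter, mem_traceClass, Finset.inter_eq_right, Finset.insert_subset_iff,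
      Finset.singleton_subset_iff]
  rw [h3]
  omega

/-! ### A pair that almost all members meet. -/

/-- At least `N` members of `F` avoid any given pair of points. -/
def PairSpread {n : ℕ} (N : ℕ) (F : Finset (Finset (Fin n))) : Prop :=
  ∀ x y, x ≠ y → N ≤ (avoid F {x, y}).card

/-- Any two points have codegree at most `D` in `F`. -/
def CodegreeLE {n : ℕ} (D : ℕ) (F : Finset (Finset (Fin n))) : Prop :=
  ∀ x y, x ≠ y → (F.filter fun S => x ∈ S ∧ y ∈ S).card ≤ D

theorem CodegreeLE.mono {n D : ℕ} {F G : Finset (Finset (Fin n))} (h : CodegreeLE D F)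
    (hG : G ⊆ F) : CodegreeLE D G := fun x y hxy =>
  (Finset.card_le_card (Finset.filter_subset_filter _ hG)).trans (h x y hxy)

theorem avoid_subset {n : ℕ} (F : Finset (Finset (Fin n))) (X : Finset (Fin n)) :
    avoid F X ⊆ F :=
  Finset.filter_subset _ _

theorem traceClass_subset {n : ℕ} (F : Finset (Finset (Fin n))) (T U : Finset (Fin n)) :
    traceClass F T U ⊆ F :=
  Finset.filter_subset _ _

theorem PairSpread.codegreeLE {n k : ℕ} (hk : 3 ≤ k) (hn : 42 * k ≤ n)
    {F : Finset (Finset (Fin n))} (hF : (F : Set (Finset (Fin n))).Sized k)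
    (hI : (F : Set (Finset (Fin n))).Intersecting)
    (h : PairSpread ((n - 3).choose (k - 3)) F) : CodegreeLE (3 * (n - 3).choose (k - 3)) F :=
  fun x y hxy => card_filter_mem_mem_le hk hn hF hI hxy (h x y hxy)

/-- A member that avoids neither set contains a point of each. -/
theorem card_le_of_covers {n D : ℕ} {F : Finset (Finset (Fin n))} {T T' : Finset (Fin n)}
    (hD : ∀ x ∈ T, ∀ y ∈ T', (F.filter fun S => x ∈ S ∧ y ∈ S).card ≤ D) :
    F.card ≤ (avoid F T).card + (avoid F T').card + T.card * T'.card * D := by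
  have hsub : F ⊆ (avoid F T ∪ avoid F T') ∪
      (T ×ˢ T').biUnion fun p => F.filter fun S => p.1 ∈ S ∧ p.2 ∈ S := by
    intro S hS
    by_cases h1 : Disjoint S T
    · exact Finset.mem_union_left _ (Finset.mem_union_left _ (mem_avoid.2 ⟨hS, h1⟩))
    by_cases h2 : Disjoint S T'
    · exact Finset.mem_union_left _ (Finset.mem_union_right _ (mem_avoid.2 ⟨hS, h2⟩))
    obtain ⟨x, hx, hx'⟩ := Finset.not_disjoint_iff.1 h1
    obtain ⟨y, hy, hy'⟩ := Finset.not_disjoint_iff.1 h2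
    exact Finset.mem_union_right _ (Finset.mem_biUnion.2
      ⟨(x, y), Finset.mem_product.2 ⟨hx', hy'⟩, Finset.mem_filter.2 ⟨hS, hx, hy⟩⟩)
  refine (Finset.card_le_card hsub).trans ((Finset.card_union_le _ _).trans
    (Nat.add_le_add (Finset.card_union_le _ _) ?_))
  refine Finset.card_biUnion_le.trans ((Finset.sum_le_card_nsmul _ _ D ?_).trans ?_)
  · intro p hp
    rw [Finset.mem_product] at hp
    exact hD _ hp.1 _ hp.2
  · rw [Finset.card_product, smul_eq_mul]

theorem CodegreeLE.card_le_of_disjoint_covers {n D : ℕ} {F : Finset (Finset (Fin n))}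
    (hD : CodegreeLE D F) {T T' : Finset (Fin n)} (hTT' : Disjoint T T') :
    F.card ≤ (avoid F T).card + (avoid F T').card + T.card * T'.card * D :=
  card_le_of_covers fun _ hx _ hy => hD _ _ fun h => Finset.disjoint_left.1 hTT' hx (h ▸ hy)

/-- In a family that is shifted outside `T`, few members meet `T` in a given point only. -/
theorem card_traceClass_singleton_le {n k N : ℕ} (hn : 42 * k ≤ n)
    (hN : (n - 3).choose (k - 3) = N) (hN0 : 0 < N)
    {F : Finset (Finset (Fin n))} (hF : (F : Set (Finset (Fin n))).Sized k)
    (hI : (F : Set (Finset (Fin n))).Intersecting) (hD : CodegreeLE (3 * N) F)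
    {T : Finset (Fin n)} (hs : ShiftedOn Tᶜ F) (hT : Tᶜ.Nonempty) {t : Fin n} (ht : t ∈ T)
    (hQ : 14 * N ≤ (avoid F {t}).card) : (traceClass F T {t}).card ≤ 5 * N := by
  -- A sparse member with trace `{t}` meets the members avoiding `t` only outside `T`, so all of
  -- these are dense: at most 3N + 40N/9 < 14N. If none is sparse, the codegree bounds those through
  -- the least `z`, and the rest are dense: at most 3N + 10N/9.
  by_cases hex : ∃ A ∈ traceClass F T {t}, SparseOn Tᶜ A
  · exfalso
    obtain ⟨A, hA, hsp⟩ := hex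
    rw [mem_traceClass] at hA
    have := nine_mul_card_le_of_codegree_of_denseOn (V := Tᶜ) (F := avoid F {t}) hn
      (hF.mono (avoid_subset _ _)) (hD.mono (avoid_subset _ _)) (by
        intro B hB
        rw [mem_avoid, Finset.disjoint_singleton_right] at hB
        refine denseOn_of_sparseOn hs hI hA.1 hB.1 (fun x hxA hxB => ?_) hsp
        rw [Finset.mem_compl]
        intro hxT
        have : x ∈ ({t} : Finset (Fin n)) := hA.2 ▸ Finset.mem_inter.2 ⟨hxA, hxT⟩
        rw [Finset.mem_singleton] at this
        exact hB.2 (this ▸ hxB))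
    omega
  · push Not at hex
    obtain ⟨z, hz, hmin⟩ := Finset.exists_min_image Tᶜ id hT
    have hzt : t ≠ z := fun h => Finset.mem_compl.1 hz (h ▸ ht)
    have htm : ∀ S ∈ traceClass F T {t}, t ∈ S := fun S hS =>
      Finset.mem_of_mem_inter_left ((mem_traceClass.1 hS).2 ▸ Finset.mem_singleton_self t)
    have h1 : ((traceClass F T {t}).filter fun S => z ∈ S).card ≤ 3 * N := by
      refine (Finset.card_le_card fun S hS => ?_).trans (hD t z hzt)
      rw [Finset.mem_filter] at hS ⊢
      exact ⟨traceClass_subset _ _ _ hS.1, htm S hS.1, hS.2⟩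
    have h2 := nine_mul_card_le_of_mem_of_denseOn hn
      (F := (traceClass F T {t}).filter fun S => z ∉ S) (V := Tᶜ.erase z) (x := t)
      (hF.mono ((Finset.filter_subset _ _).trans (traceClass_subset _ _ _))) (by simp [ht]) (by
        intro S hS
        rw [Finset.mem_filter] at hS
        exact ⟨htm S hS.1, denseOn_erase_of_not_sparseOn hz hmin hS.2 (hex S hS.1)⟩)
    have h3 := Finset.card_filter_add_card_filter_not (s := traceClass F T {t}) (fun S => z ∈ S)
    omega

/-- In a fully shifted intersecting family, the first point is avoided by few members. -/
theorem exists_card_avoid_lt_of_shiftedOn_univ {n k N : ℕ} (hn : 42 * k ≤ n) (hk : 3 ≤ k)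
    (hN : (n - 3).choose (k - 3) = N) (hN0 : 0 < N)
    {F : Finset (Finset (Fin n))} (hF : (F : Set (Finset (Fin n))).Sized k)
    (hI : (F : Set (Finset (Fin n))).Intersecting) (hD : CodegreeLE (3 * N) F)
    (hs : ShiftedOn Finset.univ F) : ∃ z, (avoid F {z}).card < 14 * N := by
  have hne : (Finset.univ : Finset (Fin n)).Nonempty := ⟨⟨0, by omega⟩, Finset.mem_univ _⟩
  obtain ⟨z, hz, hmin⟩ := Finset.exists_min_image Finset.univ id hne
  refine ⟨z, ?_⟩
  have := nine_mul_card_le_of_codegree_of_denseOn (V := Finset.univ.erase z) (F := avoid F {z}) hn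
    (hF.mono (avoid_subset _ _)) (hD.mono (avoid_subset _ _)) (by
      intro B hB
      rw [mem_avoid, Finset.disjoint_singleton_right] at hB
      -- A sparse `B`, compared with itself, would be dense.
      refine denseOn_erase_of_not_sparseOn hz hmin hB.2 fun hsp => ?_
      obtain ⟨c, hc⟩ := denseOn_of_sparseOn hs hI hB.1 hB.1 (fun x _ _ => Finset.mem_univ x) hsp
      have := hsp c
      omega)
  omega

/-- Only pairs through `i` can lose avoiding members. The other point is not `j`, because members
avoiding both `i` and `j` are not moved. -/
theorem exists_card_avoid_triple_lt {n N : ℕ} {i j : Fin n} {F : Finset (Finset (Fin n))}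
    (hP : PairSpread N F) (hij : i ≠ j) (hnP : ¬ PairSpread N (shiftFamily i j F)) :
    ∃ z, z ≠ i ∧ z ≠ j ∧ (avoid F {i, j, z}).card < N := by
  rw [PairSpread] at hnP
  push Not at hnP
  obtain ⟨x, y, hxy, h⟩ := hnP
  have key : ∀ z, i ≠ z → (avoid (shiftFamily i j F) {i, z}).card < N →
      ∃ z, z ≠ i ∧ z ≠ j ∧ (avoid F {i, j, z}).card < N := by
    intro z hz h
    have h1 := (card_avoid_insert_le_shiftFamily i j F {i, z}).trans_lt h
    by_cases hzj : z = j
    · subst hzj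
      rw [Finset.insert_eq_self.2 (by simp)] at h1
      exact absurd h1 (hP i z hz).not_gt
    · refine ⟨z, hz.symm, hzj, ?_⟩
      rwa [Finset.insert_comm]
  by_cases hxi : i = x
  · subst hxi
    exact key y hxy h
  by_cases hyi : i = y
  · subst hyi
    exact key x (Ne.symm hxy) (by rwa [Finset.pair_comm])
  · exact absurd ((card_avoid_le_shiftFamily j F (X := {x, y}) (by simp [hxi, hyi])).trans_lt h)
      (hP x y hxy).not_gt

theorem compl_nonempty_of_card_lt {n : ℕ} {T : Finset (Fin n)} (h : T.card < n) :
    Tᶜ.Nonempty := by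
  rw [← Finset.card_pos, Finset.card_compl, Fintype.card_fin]
  omega

/-- A spread intersecting family has no triple of points that almost all members meet. -/
theorem le_card_avoid_triple {n k N : ℕ} (hk : 3 ≤ k) (hn : 42 * k ≤ n)
    (hN : (n - 3).choose (k - 3) = N) (hN0 : 0 < N)
    {F : Finset (Finset (Fin n))} (hF : (F : Set (Finset (Fin n))).Sized k)
    (hI : (F : Set (Finset (Fin n))).Intersecting) (hcard : 40 * N ≤ F.card)
    (hP : PairSpread N F) (hQ : ∀ x, 14 * N ≤ (avoid F {x}).card) {T : Finset (Fin n)}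
    (hT : T.card = 3) : N ≤ (avoid F T).card := by
  by_contra! hlt
  obtain ⟨G, ⟨hF, hI, hcard, hP, hQ, hlt⟩, hG⟩ := exists_shift_stable Tᶜ
    (fun G => (G : Set (Finset (Fin n))).Sized k ∧ (G : Set (Finset (Fin n))).Intersecting ∧
      40 * N ≤ G.card ∧ PairSpread N G ∧ (∀ t ∈ T, 14 * N ≤ (avoid G {t}).card) ∧
      (avoid G T).card < N) ⟨hF, hI, hcard, hP, fun t _ => hQ t, hlt⟩
  have hD : CodegreeLE (3 * N) G := hN ▸ PairSpread.codegreeLE hk hn hF hI (hN ▸ hP)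
  rcases hG with hs | ⟨i, hi, j, hj, hij, hbad⟩
  -- Shifted case: fewer than N + 3·5N + 3·3N = 25N members.
  · obtain ⟨a, b, c, hab, hac, hbc, rfl⟩ := Finset.card_eq_three.1 hT
    have hne := compl_nonempty_of_card_lt (T := {a, b, c}) (by omega)
    have ha := card_traceClass_singleton_le hn hN hN0 hF hI hD hs hne (t := a) (by simp)
      (hQ a (by simp))
    have hb := card_traceClass_singleton_le hn hN hN0 hF hI hD hs hne (t := b) (by simp)
      (hQ b (by simp))
    have hc := card_traceClass_singleton_le hn hN hN0 hF hI hD hs hne (t := c) (by simp)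
      (hQ c (by simp))
    have h1 := hD a b hab
    have h2 := hD a c hac
    have h3 := hD b c hbc
    have hsub : G ⊆ avoid G {a, b, c} ∪ (traceClass G {a, b, c} {a} ∪
        (traceClass G {a, b, c} {b} ∪ (traceClass G {a, b, c} {c} ∪
        ((G.filter fun S => a ∈ S ∧ b ∈ S) ∪ ((G.filter fun S => a ∈ S ∧ c ∈ S) ∪
        (G.filter fun S => b ∈ S ∧ c ∈ S)))))) := by
      intro S hS
      simp only [Finset.mem_union, mem_avoid, mem_traceClass, Finset.mem_filter, hS, true_and,
        Finset.disjoint_insert_right, Finset.disjoint_singleton_right, Finset.ext_iff,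
        Finset.mem_inter, Finset.mem_insert, Finset.mem_singleton]
      by_cases h1 : a ∈ S <;> by_cases h2 : b ∈ S <;> by_cases h3 : c ∈ S <;> simp only [h1, h2, h3]
        <;> grind
    have h4 := Finset.card_le_card hsub
    have u1 := Finset.card_union_le (avoid G {a, b, c}) (traceClass G {a, b, c} {a} ∪
        (traceClass G {a, b, c} {b} ∪ (traceClass G {a, b, c} {c} ∪
        ((G.filter fun S => a ∈ S ∧ b ∈ S) ∪ ((G.filter fun S => a ∈ S ∧ c ∈ S) ∪
        (G.filter fun S => b ∈ S ∧ c ∈ S))))))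
    have u2 := Finset.card_union_le (traceClass G {a, b, c} {a})
        (traceClass G {a, b, c} {b} ∪ (traceClass G {a, b, c} {c} ∪
        ((G.filter fun S => a ∈ S ∧ b ∈ S) ∪ ((G.filter fun S => a ∈ S ∧ c ∈ S) ∪
        (G.filter fun S => b ∈ S ∧ c ∈ S)))))
    have u3 := Finset.card_union_le (traceClass G {a, b, c} {b}) (traceClass G {a, b, c} {c} ∪
        ((G.filter fun S => a ∈ S ∧ b ∈ S) ∪ ((G.filter fun S => a ∈ S ∧ c ∈ S) ∪
        (G.filter fun S => b ∈ S ∧ c ∈ S))))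
    have u4 := Finset.card_union_le (traceClass G {a, b, c} {c})
        ((G.filter fun S => a ∈ S ∧ b ∈ S) ∪ ((G.filter fun S => a ∈ S ∧ c ∈ S) ∪
        (G.filter fun S => b ∈ S ∧ c ∈ S)))
    have u5 := Finset.card_union_le (G.filter fun S => a ∈ S ∧ b ∈ S)
        ((G.filter fun S => a ∈ S ∧ c ∈ S) ∪ (G.filter fun S => b ∈ S ∧ c ∈ S))
    have u6 := Finset.card_union_le (G.filter fun S => a ∈ S ∧ c ∈ S)
      (G.filter fun S => b ∈ S ∧ c ∈ S)
    omega
  · rw [Finset.mem_compl] at hi hj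
    have hnP : ¬ PairSpread N (shiftFamily i j G) := fun hP' => hbad
      ⟨sized_shiftFamily i j hF, intersecting_shiftFamily i j hI,
        by rwa [card_shiftFamily], hP', fun t ht => (hQ t ht).trans
          (card_avoid_le_shiftFamily j G (by rintro h; exact hi (Finset.mem_singleton.1 h ▸ ht))),
        by rwa [card_avoid_shiftFamily_eq G hi hj]⟩
    obtain ⟨z, hzi, hzj, hz⟩ := exists_card_avoid_triple_lt hP hij.ne hnP
    -- Few members avoid `{i, j, z}` either. If `z ∈ T`, fewer than 2N + 4·3N = 14N members avoid
    -- `z`, which is where 14 comes from. If `z ∉ T`, the triples are disjoint and there are fewer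
    -- than 2N + 9·3N members in all.
    by_cases hzT : z ∈ T
    · have h1 := (hD.mono (avoid_subset G {z})).card_le_of_disjoint_covers (T := T.erase z)
        (T' := {i, j}) (by simp [hi, hj])
      rw [Finset.card_erase_of_mem hzT, hT, Finset.card_pair hij.ne] at h1
      have h2 : (avoid (avoid G {z}) (T.erase z)).card ≤ (avoid G T).card := by
        refine Finset.card_le_card fun S hS => ?_
        rw [mem_avoid, mem_avoid, Finset.disjoint_singleton_right] at hS
        rw [mem_avoid, ← Finset.insert_erase hzT, Finset.disjoint_insert_right]
        exact ⟨hS.1.1, hS.1.2, hS.2⟩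
      have h3 : (avoid (avoid G {z}) {i, j}).card ≤ (avoid G {i, j, z}).card := by
        refine Finset.card_le_card fun S hS => ?_
        simp only [mem_avoid, Finset.disjoint_insert_right, Finset.disjoint_singleton_right] at hS ⊢
        tauto
      have h4 := hQ z hzT
      omega
    · have h1 := hD.card_le_of_disjoint_covers (T := T) (T' := {i, j, z}) (by simp [hi, hj, hzT])
      rw [hT, Finset.card_eq_three.2 ⟨i, j, z, hij.ne, hzi.symm, hzj.symm, rfl⟩] at h1
      omega

theorem card_avoid_pair_lt_of_not_le {n M : ℕ} {i j : Fin n} {F : Finset (Finset (Fin n))}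
    (hQ : ∀ x, M ≤ (avoid F {x}).card)
    (h : ¬ ∀ x, M ≤ (avoid (shiftFamily i j F) {x}).card) : (avoid F {i, j}).card < M := by
  push Not at h
  obtain ⟨x, hx⟩ := h
  by_cases hxi : i = x
  · subst hxi
    rw [Finset.pair_comm]
    exact (card_avoid_insert_le_shiftFamily i j F {i}).trans_lt hx
  · exact absurd ((card_avoid_le_shiftFamily j F (X := {x}) (by simp [hxi])).trans_lt hx)
      (hQ x).not_gt

/-- A large intersecting family without a point of almost full degree has a pair of points that
almost all members meet. -/
theorem exists_card_avoid_pair_lt {n k N : ℕ} (hk : 3 ≤ k) (hn : 42 * k ≤ n)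
    (hN : (n - 3).choose (k - 3) = N) (hN0 : 0 < N)
    {F : Finset (Finset (Fin n))} (hF : (F : Set (Finset (Fin n))).Sized k)
    (hI : (F : Set (Finset (Fin n))).Intersecting) (hcard : 40 * N ≤ F.card)
    (hQ : ∀ x, 14 * N ≤ (avoid F {x}).card) : ∃ x y, x ≠ y ∧ (avoid F {x, y}).card < N := by
  by_contra! hP
  have hP : PairSpread N F := hP
  obtain ⟨G, ⟨hF, hI, hcard, hP, hQ⟩, hG⟩ := exists_shift_stable Finset.univ
    (fun G => (G : Set (Finset (Fin n))).Sized k ∧ (G : Set (Finset (Fin n))).Intersecting ∧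
      40 * N ≤ G.card ∧ PairSpread N G ∧ ∀ t, 14 * N ≤ (avoid G {t}).card)
    ⟨hF, hI, hcard, hP, hQ⟩
  rcases hG with hs | ⟨i, -, j, -, hij, hbad⟩
  · have hD : CodegreeLE (3 * N) G := hN ▸ PairSpread.codegreeLE hk hn hF hI (hN ▸ hP)
    obtain ⟨z, hz⟩ := exists_card_avoid_lt_of_shiftedOn_univ hn hk hN hN0 hF hI hD hs
    exact absurd hz (hQ z).not_gt
  -- Pair spread is never lost, by `le_card_avoid_triple`; a shift can break only the condition on
  -- single points.
  have triple : ∀ G : Finset (Finset (Fin n)), (G : Set (Finset (Fin n))).Sized k →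
      (G : Set (Finset (Fin n))).Intersecting → 40 * N ≤ G.card → PairSpread N G →
      (∀ t, 14 * N ≤ (avoid G {t}).card) → ∀ i j, i ≠ j → PairSpread N (shiftFamily i j G) := by
    intro G hF hI hcard hP hQ i j hij
    by_contra hnP
    obtain ⟨z, hzi, hzj, hz⟩ := exists_card_avoid_triple_lt hP hij hnP
    exact absurd hz (le_card_avoid_triple hk hn hN hN0 hF hI hcard hP hQ
      (Finset.card_eq_three.2 ⟨i, j, z, hij, hzi.symm, hzj.symm, rfl⟩)).not_gt
  have hpair : (avoid G {i, j}).card < 14 * N := card_avoid_pair_lt_of_not_le hQ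
    fun hQ' => hbad ⟨sized_shiftFamily i j hF, intersecting_shiftFamily i j hI,
      by rwa [card_shiftFamily], triple G hF hI hcard hP hQ i j hij.ne, hQ'⟩
  obtain ⟨H, ⟨hF, hI, hcard, hP, hQ, hpair⟩, hH⟩ := exists_shift_stable ({i, j} : Finset (Fin n))ᶜ
    (fun G => (G : Set (Finset (Fin n))).Sized k ∧ (G : Set (Finset (Fin n))).Intersecting ∧
      40 * N ≤ G.card ∧ PairSpread N G ∧ (∀ t, 14 * N ≤ (avoid G {t}).card) ∧
      (avoid G {i, j}).card < 14 * N)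
    ⟨hF, hI, hcard, hP, hQ, hpair⟩
  have hD : CodegreeLE (3 * N) H := hN ▸ PairSpread.codegreeLE hk hn hF hI (hN ▸ hP)
  have hc2 : ({i, j} : Finset (Fin n)).card = 2 := Finset.card_pair hij.ne
  -- Shifted case: fewer than 14N + 2·5N + 3N members. Otherwise a second, disjoint pair appears,
  -- and there are fewer than 2·14N + 4·3N = 40N members, which explains the 40.
  rcases hH with hs | ⟨a, ha, b, hb, hab, hbad⟩
  · have hne := compl_nonempty_of_card_lt (T := {i, j}) (by omega)
    have h1 := card_traceClass_singleton_le hn hN hN0 hF hI hD hs hne (t := i) (by simp) (hQ i)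
    have h2 := card_traceClass_singleton_le hn hN hN0 hF hI hD hs hne (t := j) (by simp) (hQ j)
    have h3 := hD i j hij.ne
    have hsub : H ⊆ avoid H {i, j} ∪ (traceClass H {i, j} {i} ∪ (traceClass H {i, j} {j} ∪
        (H.filter fun S => i ∈ S ∧ j ∈ S))) := by
      intro S hS
      simp only [Finset.mem_union, mem_avoid, mem_traceClass, Finset.mem_filter, hS, true_and,
        Finset.disjoint_insert_right, Finset.disjoint_singleton_right, Finset.ext_iff,
        Finset.mem_inter, Finset.mem_insert, Finset.mem_singleton]
      by_cases h1 : i ∈ S <;> by_cases h2 : j ∈ S <;> simp only [h1, h2] <;> grind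
    have h4 := Finset.card_le_card hsub
    have u1 := Finset.card_union_le (avoid H {i, j}) (traceClass H {i, j} {i} ∪
      (traceClass H {i, j} {j} ∪ (H.filter fun S => i ∈ S ∧ j ∈ S)))
    have u2 := Finset.card_union_le (traceClass H {i, j} {i}) (traceClass H {i, j} {j} ∪
      (H.filter fun S => i ∈ S ∧ j ∈ S))
    have u3 := Finset.card_union_le (traceClass H {i, j} {j}) (H.filter fun S => i ∈ S ∧ j ∈ S)
    omega
  · rw [Finset.mem_compl] at ha hb
    have hpair' : (avoid H {a, b}).card < 14 * N := card_avoid_pair_lt_of_not_le hQ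
      fun hQ' => hbad ⟨sized_shiftFamily a b hF, intersecting_shiftFamily a b hI,
        by rwa [card_shiftFamily], triple H hF hI hcard hP hQ a b hab.ne, hQ',
        by rwa [card_avoid_shiftFamily_eq H ha hb]⟩
    have h1 := hD.card_le_of_disjoint_covers (T := {i, j}) (T' := {a, b})
      (by simp only [Finset.disjoint_insert_right, Finset.disjoint_singleton_right]; exact ⟨ha, hb⟩)
    rw [hc2, Finset.card_pair hab.ne] at h1
    omega

/-! ### From the pair to a triangle. -/

theorem card_avoid_anti {n : ℕ} (F : Finset (Finset (Fin n))) {X Y : Finset (Fin n)}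
    (h : X ⊆ Y) : (avoid F Y).card ≤ (avoid F X).card :=
  Finset.card_le_card fun S hS => by
    rw [mem_avoid] at hS ⊢
    exact ⟨hS.1, hS.2.mono_right h⟩

theorem card_le_of_not_sparseOn {n k N : ℕ} (hn : 42 * k ≤ n)
    (hN : (n - 3).choose (k - 3) = N)
    {F : Finset (Finset (Fin n))} (hF : (F : Set (Finset (Fin n))).Sized k) {V : Finset (Fin n)}
    (hV : V.Nonempty) {x i : Fin n} (hx : x ∉ V) (hi : i ∉ V) (hxi : x ≠ i)
    (h : ∀ S ∈ F, x ∈ S ∧ i ∈ S ∧ ¬ SparseOn V S) : F.card ≤ 3 * N := by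
  obtain ⟨z, hz, hmin⟩ := Finset.exists_min_image V id hV
  have h1 : (F.filter fun S => z ∈ S).card ≤ N := by
    have hc : ({x, i, z} : Finset (Fin n)).card = 3 :=
      Finset.card_eq_three.2 ⟨x, i, z, hxi, fun h => hx (h ▸ hz), fun h => hi (h ▸ hz), rfl⟩
    have := card_filter_superset_le hF {x, i, z}
    rw [hc, hN] at this
    refine (Finset.card_le_card fun S hS => ?_).trans this
    rw [Finset.mem_filter] at hS ⊢
    have := h S hS.1
    refine ⟨hS.1, ?_⟩
    simp [Finset.insert_subset_iff, this.1, this.2.1, hS.2]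
  have h2 := nine_mul_card_le_of_mem_of_denseOn hn
    (F := F.filter fun S => z ∉ S) (V := V.erase z) (x := x)
    (hF.mono (Finset.filter_subset _ _)) (by simp [hx]) (by
      intro S hS
      rw [Finset.mem_filter] at hS
      exact ⟨(h S hS.1).1, denseOn_erase_of_not_sparseOn hz hmin hS.2 (h S hS.1).2.2⟩)
  have h3 := Finset.card_filter_add_card_filter_not (s := F) (fun S => z ∈ S)
  omega

/-- Members avoiding `X` meet `A` only inside `V`, hence are dense; at most 10N/9 dense ones contain
`y`. -/
theorem nine_mul_card_avoid_le_of_sparseOn {n k N : ℕ} (hn : 42 * k ≤ n)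
    (hN : (n - 3).choose (k - 3) = N)
    {F : Finset (Finset (Fin n))} (hF : (F : Set (Finset (Fin n))).Sized k)
    (hI : (F : Set (Finset (Fin n))).Intersecting) {V : Finset (Fin n)} (hs : ShiftedOn V F)
    {A X : Finset (Fin n)} (hA : A ∈ F) (hsp : SparseOn V A) (hAX : ∀ x ∈ A, x ∉ X → x ∈ V)
    {y : Fin n} (hy : y ∉ V) :
    9 * (avoid F X).card ≤ 9 * (avoid F (insert y X)).card + 10 * N := by
  have h1 := nine_mul_card_le_of_mem_of_denseOn hn
    (F := (avoid F X).filter fun S => y ∈ S) (V := V) (x := y)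
    (hF.mono ((Finset.filter_subset _ _).trans (avoid_subset _ _))) hy (by
      intro S hS
      rw [Finset.mem_filter, mem_avoid] at hS
      exact ⟨hS.2, denseOn_of_sparseOn hs hI hA hS.1.1 (fun x hxA hxS => hAX x hxA
        (Finset.disjoint_left.1 hS.1.2 hxS)) hsp⟩)
  have h2 : ((avoid F X).filter fun S => y ∉ S).card ≤ (avoid F (insert y X)).card := by
    refine Finset.card_le_card fun S hS => ?_
    rw [Finset.mem_filter, mem_avoid] at hS
    rw [mem_avoid, Finset.disjoint_insert_right]
    exact ⟨hS.1.1, hS.2, hS.1.2⟩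
  have h3 := Finset.card_filter_add_card_filter_not (s := avoid F X) (fun S => y ∈ S)
  omega

/-- A member with `x` and without `y` is never sparse: else fewer than 19N/9 members would avoid
`x`. So those that also miss the least point `z` are dense, hence few. -/
theorem nine_mul_card_avoid_lt_of_shiftedOn {n k N : ℕ} (hn : 42 * k ≤ n)
    (hN : (n - 3).choose (k - 3) = N)
    {F : Finset (Finset (Fin n))} (hF : (F : Set (Finset (Fin n))).Sized k)
    (hI : (F : Set (Finset (Fin n))).Intersecting) {x y z : Fin n}
    (hs : ShiftedOn ({x, y} : Finset (Fin n))ᶜ F)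
    (hz : z ∈ ({x, y} : Finset (Fin n))ᶜ) (hmin : ∀ v ∈ ({x, y} : Finset (Fin n))ᶜ, z ≤ v)
    (hxy' : (avoid F {x, y}).card < N) (hx : 40 * N ≤ (avoid F {x}).card) :
    9 * (avoid F {y, z}).card < 19 * N := by
  have hnsp : ∀ A ∈ F, x ∈ A → y ∉ A → ¬ SparseOn ({x, y} : Finset (Fin n))ᶜ A := by
    intro A hA hxA hyA hsp
    have := nine_mul_card_avoid_le_of_sparseOn hn hN hF hI hs hA hsp (X := {x}) (y := y) (by
      intro v hv hvx
      simp only [Finset.mem_compl, Finset.mem_insert, Finset.mem_singleton, not_or] at hvx ⊢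
      exact ⟨hvx, fun h => hyA (h ▸ hv)⟩) (by simp)
    rw [Finset.pair_comm] at this
    omega
  have h1 := nine_mul_card_le_of_mem_of_denseOn hn
    (F := (avoid F {y, z}).filter fun S => x ∈ S) (V := ({x, y} : Finset (Fin n))ᶜ.erase z) (x := x)
    (hF.mono ((Finset.filter_subset _ _).trans (avoid_subset _ _))) (by simp) (by
      intro S hS
      rw [Finset.mem_filter, mem_avoid, Finset.disjoint_insert_right,
        Finset.disjoint_singleton_right] at hS
      exact ⟨hS.2, denseOn_erase_of_not_sparseOn hz hmin hS.1.2.2 (hnsp S hS.1.1 hS.2 hS.1.2.1)⟩)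
  have h2 : ((avoid F {y, z}).filter fun S => x ∉ S).card ≤ (avoid F {x, y}).card := by
    refine Finset.card_le_card fun S hS => ?_
    simp only [Finset.mem_filter, mem_avoid, Finset.disjoint_insert_right,
      Finset.disjoint_singleton_right] at hS ⊢
    tauto
  have h3 := Finset.card_filter_add_card_filter_not (s := avoid F {y, z}) (fun S => x ∈ S)
  omega

/-- If, outside four points, the family is shifted, then one of two candidate points completes
the pair to a triangle. -/
theorem card_avoid_add_card_avoid_lt_of_shiftedOn {n k N : ℕ} (hk : 3 ≤ k) (hn : 42 * k ≤ n)
    (hN : (n - 3).choose (k - 3) = N)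
    {F : Finset (Finset (Fin n))} (hF : (F : Set (Finset (Fin n))).Sized k)
    (hI : (F : Set (Finset (Fin n))).Intersecting) {x y i j : Fin n} (hxi : x ≠ i)
    (hyi : y ≠ i) (hyj : y ≠ j) (hij : i ≠ j)
    (hs : ShiftedOn ({x, y, i, j} : Finset (Fin n))ᶜ F)
    (hxy' : (avoid F {x, y}).card < N) (hx : 40 * N ≤ (avoid F {x}).card)
    (h : 3 * N < (F.filter fun S => x ∈ S ∧ i ∈ S ∧ y ∉ S ∧ j ∉ S).card) :
    (avoid F {x, i}).card + (avoid F {y, i}).card < 5 * N := by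
  have hne : ({x, y, i, j} : Finset (Fin n))ᶜ.Nonempty := compl_nonempty_of_card_lt
    (lt_of_le_of_lt Finset.card_le_four (by omega))
  -- More than 3N members of this type cannot all be non-sparse. A sparse one makes the members
  -- avoiding `x` and `i` dense, so all but 10N/9 of them also avoid `y`.
  have key : ∀ x y : Fin n, x ≠ i → ShiftedOn ({x, y, i, j} : Finset (Fin n))ᶜ F →
      ({x, y, i, j} : Finset (Fin n))ᶜ.Nonempty → (avoid F {x, y}).card < N →
      3 * N < (F.filter fun S => x ∈ S ∧ i ∈ S ∧ y ∉ S ∧ j ∉ S).card →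
      9 * (avoid F {x, i}).card < 19 * N := by
    intro x y hxi hs hne hxy' h
    obtain ⟨A, hA, hsp⟩ : ∃ A ∈ F.filter fun S => x ∈ S ∧ i ∈ S ∧ y ∉ S ∧ j ∉ S,
        SparseOn ({x, y, i, j} : Finset (Fin n))ᶜ A := by
      by_contra! hn'
      refine absurd h (not_lt.2 (card_le_of_not_sparseOn hn hN
        (hF.mono (Finset.filter_subset _ _)) hne (x := x) (i := i) (by simp) (by simp) hxi ?_))
      intro S hS
      have := hn' S hS
      rw [Finset.mem_filter] at hS
      exact ⟨hS.2.1, hS.2.2.1, this⟩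
    rw [Finset.mem_filter] at hA
    have h1 := nine_mul_card_avoid_le_of_sparseOn hn hN hF hI hs hA.1 hsp (X := {x, i}) (y := y) (by
      intro v hv hvx
      simp only [Finset.mem_compl, Finset.mem_insert, Finset.mem_singleton, not_or] at hvx ⊢
      exact ⟨hvx.1, fun h => hA.2.2.2.1 (h ▸ hv), hvx.2, fun h => hA.2.2.2.2 (h ▸ hv)⟩) (by simp)
    have h2 := card_avoid_anti F (X := {x, y}) (Y := insert y {x, i}) (by
      intro v; simp only [Finset.mem_insert, Finset.mem_singleton]; tauto)
    omega
  have h1 := key x y hxi hs hne hxy' h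
  -- Most of the 40N members avoiding `x` are of the same type with `x` and `y` exchanged, so `key`
  -- applies again.
  have hsub : avoid F {x} ⊆ (avoid F {x, y} ∪ avoid F {x, i}) ∪
      ((F.filter fun S => {y, i, j} ⊆ S) ∪
        (F.filter fun S => y ∈ S ∧ i ∈ S ∧ x ∉ S ∧ j ∉ S)) := by
    intro S hS
    simp only [Finset.mem_union, mem_avoid, Finset.mem_filter, Finset.disjoint_insert_right,
      Finset.disjoint_singleton_right, Finset.insert_subset_iff,
      Finset.singleton_subset_iff] at hS ⊢
    tauto
  have h2 := Finset.card_le_card hsub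
  have u1 := Finset.card_union_le (avoid F {x, y} ∪ avoid F {x, i})
    ((F.filter fun S => {y, i, j} ⊆ S) ∪ (F.filter fun S => y ∈ S ∧ i ∈ S ∧ x ∉ S ∧ j ∉ S))
  have u2 := Finset.card_union_le (avoid F {x, y}) (avoid F {x, i})
  have u3 := Finset.card_union_le (F.filter fun S => {y, i, j} ⊆ S)
    (F.filter fun S => y ∈ S ∧ i ∈ S ∧ x ∉ S ∧ j ∉ S)
  have h3 := card_filter_superset_le hF {y, i, j}
  rw [Finset.card_eq_three.2 ⟨y, i, j, hyi, hyj, hij, rfl⟩, hN] at h3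
  have hcomm : ({x, y, i, j} : Finset (Fin n)) = {y, x, i, j} := Finset.insert_comm _ _ _
  have h4 := key y x hyi (hcomm ▸ hs) (hcomm ▸ hne) (by rwa [Finset.pair_comm]) (by omega)
  omega

/-- A pair of points that almost all members meet extends to a triple of points such that almost
all members contain at least two of the three. -/
theorem exists_card_avoid_add_card_avoid_lt {n k N : ℕ} (hk : 3 ≤ k) (hn : 42 * k ≤ n)
    (hN : (n - 3).choose (k - 3) = N)
    {F : Finset (Finset (Fin n))} (hF : (F : Set (Finset (Fin n))).Sized k)
    (hI : (F : Set (Finset (Fin n))).Intersecting) {x y : Fin n} (hxy : x ≠ y)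
    (hxy' : (avoid F {x, y}).card < N) (hx : 40 * N ≤ (avoid F {x}).card)
    (hy : 40 * N ≤ (avoid F {y}).card) :
    ∃ z, z ≠ x ∧ z ≠ y ∧ (avoid F {x, z}).card + (avoid F {y, z}).card < 5 * N := by
  by_contra! hR
  have notMem : ∀ v : Fin n, v ∉ ({x, y} : Finset (Fin n)) → v ≠ x ∧ v ≠ y := by
    intro v hv
    simpa using hv
  have shiftGood : ∀ G : Finset (Finset (Fin n)), (G : Set (Finset (Fin n))).Sized k →
      (G : Set (Finset (Fin n))).Intersecting → (avoid G {x, y}).card < N →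
      40 * N ≤ (avoid G {x}).card → 40 * N ≤ (avoid G {y}).card → ∀ i j, i ≠ x → i ≠ y → j ≠ x →
      j ≠ y → ((shiftFamily i j G : Set (Finset (Fin n))).Sized k ∧
        (shiftFamily i j G : Set (Finset (Fin n))).Intersecting ∧
        (avoid (shiftFamily i j G) {x, y}).card < N ∧
        40 * N ≤ (avoid (shiftFamily i j G) {x}).card ∧
        40 * N ≤ (avoid (shiftFamily i j G) {y}).card) := by
    intro G hF hI hxy' hx hy i j hix hiy hjx hjy
    refine ⟨sized_shiftFamily i j hF, intersecting_shiftFamily i j hI, ?_, ?_, ?_⟩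
    · rwa [card_avoid_shiftFamily_eq G (by simp [hix, hiy]) (by simp [hjx, hjy])]
    · rwa [card_avoid_shiftFamily_eq G (by simp [hix]) (by simp [hjx])]
    · rwa [card_avoid_shiftFamily_eq G (by simp [hiy]) (by simp [hjy])]
  -- The sum can fall only at `z = i`, and members that also avoid `j` are not moved.
  have stuck : ∀ G : Finset (Finset (Fin n)),
      (∀ z, z ≠ x → z ≠ y → 5 * N ≤ (avoid G {x, z}).card + (avoid G {y, z}).card) → ∀ i j,
      i ≠ x → i ≠ y → j ≠ x → j ≠ y →
      (¬ ∀ z, z ≠ x → z ≠ y → 5 * N ≤ (avoid (shiftFamily i j G) {x, z}).card +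
        (avoid (shiftFamily i j G) {y, z}).card) →
      (avoid G {x, i, j}).card + (avoid G {y, i, j}).card < 5 * N := by
    intro G hR i j hix hiy hjx hjy hn'
    push Not at hn'
    obtain ⟨z, hzx, hzy, hz⟩ := hn'
    by_cases hiz : i = z
    · subst hiz
      have h1 := card_avoid_insert_le_shiftFamily i j G {x, i}
      have h2 := card_avoid_insert_le_shiftFamily i j G {y, i}
      rw [Finset.insert_comm, Finset.pair_comm j i] at h1 h2
      omega
    · have h1 := card_avoid_le_shiftFamily j G (X := {x, z}) (i := i) (by simp [hix, hiz])
      have h2 := card_avoid_le_shiftFamily j G (X := {y, z}) (i := i) (by simp [hiy, hiz])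
      have := hR z hzx hzy
      omega
  obtain ⟨G, ⟨⟨hF, hI, hxy', hx, hy⟩, hR⟩, hG⟩ := exists_shift_stable ({x, y} : Finset (Fin n))ᶜ
    (fun G => ((G : Set (Finset (Fin n))).Sized k ∧ (G : Set (Finset (Fin n))).Intersecting ∧
      (avoid G {x, y}).card < N ∧ 40 * N ≤ (avoid G {x}).card ∧ 40 * N ≤ (avoid G {y}).card) ∧
      ∀ z, z ≠ x → z ≠ y → 5 * N ≤ (avoid G {x, z}).card + (avoid G {y, z}).card)
    ⟨⟨hF, hI, hxy', hx, hy⟩, hR⟩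
  rcases hG with hs | ⟨i, hi, j, hj, hij, hbad⟩
  · have hne := compl_nonempty_of_card_lt (T := {x, y}) (by rw [Finset.card_pair hxy]; omega)
    obtain ⟨z, hz, hmin⟩ := Finset.exists_min_image _ id hne
    -- The least point outside the pair completes the triangle: the two counts add to less than
    -- 2·19N/9 < 5N.
    have h1 := nine_mul_card_avoid_lt_of_shiftedOn hn hN hF hI hs hz hmin hxy' hx
    have h2 := nine_mul_card_avoid_lt_of_shiftedOn hn hN hF hI (x := y) (y := x) (z := z)
      (by rwa [Finset.pair_comm]) (by rwa [Finset.pair_comm]) (by rwa [Finset.pair_comm])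
      (by rwa [Finset.pair_comm]) hy
    obtain ⟨hzx, hzy⟩ := notMem z (Finset.mem_compl.1 hz)
    have := hR z hzx hzy
    omega
  obtain ⟨hix, hiy⟩ := notMem i (Finset.mem_compl.1 hi)
  obtain ⟨hjx, hjy⟩ := notMem j (Finset.mem_compl.1 hj)
  have hpair := stuck G hR i j hix hiy hjx hjy fun h =>
    hbad ⟨shiftGood G hF hI hxy' hx hy i j hix hiy hjx hjy, h⟩
  obtain ⟨H, ⟨⟨hF, hI, hxy', hx, hy⟩, hR, hpair⟩, hH⟩ :=
    exists_shift_stable ({x, y, i, j} : Finset (Fin n))ᶜ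
    (fun G => ((G : Set (Finset (Fin n))).Sized k ∧ (G : Set (Finset (Fin n))).Intersecting ∧
      (avoid G {x, y}).card < N ∧ 40 * N ≤ (avoid G {x}).card ∧ 40 * N ≤ (avoid G {y}).card) ∧
      (∀ z, z ≠ x → z ≠ y → 5 * N ≤ (avoid G {x, z}).card + (avoid G {y, z}).card) ∧
      (avoid G {x, i, j}).card + (avoid G {y, i, j}).card < 5 * N)
    ⟨⟨hF, hI, hxy', hx, hy⟩, hR, hpair⟩
  have hsplit : (avoid H {y}).card ≤
      (avoid H {x, y}).card + ((avoid H {y}).filter fun S => x ∈ S).card := by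
    have h1 : ((avoid H {y}).filter fun S => x ∉ S).card ≤ (avoid H {x, y}).card := by
      refine Finset.card_le_card fun S hS => ?_
      simp only [Finset.mem_filter, mem_avoid, Finset.disjoint_insert_right,
        Finset.disjoint_singleton_right] at hS ⊢
      grind
    have h2 := Finset.card_filter_add_card_filter_not (s := avoid H {y}) (fun S => x ∈ S)
    omega
  -- Both cases contradict the 40N members avoiding `y`: there are fewer than N + (5N + N + 2·3N) in
  -- the shifted case and fewer than N + (2·5N + 4N) otherwise.
  rcases hH with hs | ⟨a, ha, b, hb, hab, hbad⟩
  · have h1 : ∀ i j : Fin n, i ≠ x → i ≠ y → j ≠ x → j ≠ y → i ≠ j →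
        ShiftedOn ({x, y, i, j} : Finset (Fin n))ᶜ H →
        (H.filter fun S => x ∈ S ∧ i ∈ S ∧ y ∉ S ∧ j ∉ S).card ≤ 3 * N := by
      intro i j hix hiy hjx hjy hij hs
      by_contra! hlt
      exact absurd (card_avoid_add_card_avoid_lt_of_shiftedOn hk hn hN hF hI hix.symm
        hiy.symm hjy.symm hij hs hxy' hx hlt) (hR i hix hiy).not_gt
    have h2 := h1 i j hix hiy hjx hjy hij.ne hs
    have h3 := h1 j i hjx hjy hix hiy hij.ne' (by rwa [Finset.pair_comm j i])
    have hsub : ((avoid H {y}).filter fun S => x ∈ S) ⊆ (avoid H {y, i, j} ∪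
        (H.filter fun S => {x, i, j} ⊆ S)) ∪
        ((H.filter fun S => x ∈ S ∧ i ∈ S ∧ y ∉ S ∧ j ∉ S) ∪
        (H.filter fun S => x ∈ S ∧ j ∈ S ∧ y ∉ S ∧ i ∉ S)) := by
      intro S hS
      simp only [Finset.mem_union, mem_avoid, Finset.mem_filter, Finset.disjoint_insert_right,
        Finset.disjoint_singleton_right, Finset.insert_subset_iff,
        Finset.singleton_subset_iff] at hS ⊢
      grind
    have h4 := Finset.card_le_card hsub
    have u1 := Finset.card_union_le (avoid H {y, i, j} ∪ (H.filter fun S => {x, i, j} ⊆ S))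
      ((H.filter fun S => x ∈ S ∧ i ∈ S ∧ y ∉ S ∧ j ∉ S) ∪
        (H.filter fun S => x ∈ S ∧ j ∈ S ∧ y ∉ S ∧ i ∉ S))
    have u2 := Finset.card_union_le (avoid H {y, i, j}) (H.filter fun S => {x, i, j} ⊆ S)
    have u3 := Finset.card_union_le (H.filter fun S => x ∈ S ∧ i ∈ S ∧ y ∉ S ∧ j ∉ S)
      (H.filter fun S => x ∈ S ∧ j ∈ S ∧ y ∉ S ∧ i ∉ S)
    have h5 := card_filter_superset_le hF {x, i, j}
    rw [Finset.card_eq_three.2 ⟨x, i, j, hix.symm, hjx.symm, hij.ne, rfl⟩, hN] at h5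
    omega
  · simp only [Finset.mem_compl, Finset.mem_insert, Finset.mem_singleton, not_or] at ha hb
    obtain ⟨hax, hay, hai, haj⟩ := ha
    obtain ⟨hbx, hby, hbi, hbj⟩ := hb
    have hpair' := stuck H hR a b hax hay hbx hby fun h =>
      hbad ⟨shiftGood H hF hI hxy' hx hy a b hax hay hbx hby, h, by
        rwa [card_avoid_shiftFamily_eq H (X := {x, i, j}) (by simp [hax, hai, haj])
          (by simp [hbx, hbi, hbj]), card_avoid_shiftFamily_eq H (X := {y, i, j})
          (by simp [hay, hai, haj]) (by simp [hby, hbi, hbj])]⟩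
    have hsub : ∀ u v : Fin n, avoid ((avoid H {y}).filter fun S => x ∈ S) {u, v} ⊆
        avoid H {y, u, v} := by
      intro u v S hS
      simp only [Finset.mem_filter, mem_avoid, Finset.disjoint_insert_right,
        Finset.disjoint_singleton_right] at hS ⊢
      grind
    have h1 := Finset.card_le_card (hsub i j)
    have h2 := Finset.card_le_card (hsub a b)
    have h3 := card_le_of_covers (F := (avoid H {y}).filter fun S => x ∈ S) (T := {i, j})
      (T' := {a, b}) (D := N) (by
        intro u hu v hv
        have hxu : x ≠ u := by
          rintro rfl
          simp [hix.symm, hjx.symm] at hu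
        have hxv : x ≠ v := by
          rintro rfl
          simp [Ne.symm hax, Ne.symm hbx] at hv
        have huv : u ≠ v := by
          simp only [Finset.mem_insert, Finset.mem_singleton] at hu hv
          grind
        have := card_filter_superset_le hF {x, u, v}
        rw [Finset.card_eq_three.2 ⟨x, u, v, hxu, hxv, huv, rfl⟩, hN] at this
        refine (Finset.card_le_card fun S hS => ?_).trans this
        simp only [Finset.mem_filter, mem_avoid, Finset.insert_subset_iff,
          Finset.singleton_subset_iff] at hS ⊢
        grind)
    rw [Finset.card_pair hij.ne, Finset.card_pair hab.ne] at h3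
    omega

/-! ### Trading small traces on a triple against two-point traces. -/

theorem choose_mono_of_le_half {m r s : ℕ} (hrs : r ≤ s) (hs : 2 * s ≤ m) :
    m.choose r ≤ m.choose s := by
  induction s, hrs using Nat.le_induction with
  | base => exact le_rfl
  | succ s hrs ih => exact (ih (by omega)).trans (Nat.choose_le_succ_of_lt_half_left (by omega))

theorem card_traceClass_le {n k : ℕ} {F : Finset (Finset (Fin n))}
    (hF : (F : Set (Finset (Fin n))).Sized k) (T U : Finset (Fin n)) :
    (traceClass F T U).card ≤ (n - T.card).choose (k - U.card) := by
  rw [← card_image_sdiff_traceClass]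
  refine (Finset.card_le_card (t := Finset.powersetCard (k - U.card) Tᶜ) fun X hX => ?_).trans ?_
  · refine Finset.mem_powersetCard.2 ⟨?_, sized_image_sdiff_traceClass hF T U hX⟩
    obtain ⟨S, -, rfl⟩ := Finset.mem_image.1 hX
    intro x hx
    simpa using (Finset.mem_sdiff.1 hx).2
  · rw [Finset.card_powersetCard, Finset.card_compl, Fintype.card_fin]

/-- The two binomials have ratio `(n - k) / (k - 2)`, and `ε * (n - k) ≥ 42 * k - k`. -/
theorem fortyOne_mul_choose_le {ε : ℝ} (hε : ε ≤ 1) {n k : ℕ} (hk : 3 ≤ k)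
    (hn : 42 * (k : ℝ) ≤ ε * n) (hkn : 42 * k ≤ n) :
    41 * ((n - 3).choose (k - 3) : ℝ) ≤ ε * ((n - 3).choose (k - 2) : ℝ) := by
  have h := Nat.choose_succ_right_eq (n - 3) (k - 3)
  rw [show k - 3 + 1 = k - 2 by omega, show n - 3 - (k - 3) = n - k by omega] at h
  have h' : ((n - 3).choose (k - 2) : ℝ) * (k - 2) = (n - 3).choose (k - 3) * (n - k) := by
    have := congrArg (Nat.cast : ℕ → ℝ) h
    rwa [Nat.cast_mul, Nat.cast_mul, Nat.cast_sub (by omega), Nat.cast_sub (by omega)] at this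
  have hk' : (3 : ℝ) ≤ k := by exact_mod_cast hk
  refine le_of_mul_le_mul_right ?_ (show (0 : ℝ) < k - 2 by linarith)
  rw [mul_assoc ε, h']
  have h1 : ε * (n - k) ≥ 41 * (k - 2) := by nlinarith
  calc 41 * ((n - 3).choose (k - 3) : ℝ) * (k - 2)
      = (n - 3).choose (k - 3) * (41 * (k - 2)) := by ring
    _ ≤ (n - 3).choose (k - 3) * (ε * (n - k)) := mul_le_mul_of_nonneg_left h1 (by positivity)
    _ = _ := by ring

/-- The left binomial is at most `2 * q.choose (k - 3)`, and passing from `k - 3` to `k - 2` gains a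
factor of at least `12 / ε`. -/
theorem six_mul_choose_le {ε : ℝ} (hε : ε ≤ 1) (hε0 : 0 < ε) {n k q r : ℕ} (hk : 4 ≤ k)
    (hn : 42 * (k : ℝ) ≤ ε * n) (hkn : 42 * k ≤ n) (hq : n ≤ q + 3 + k) (hr : r ≤ k - 3) :
    6 * ((q + 1).choose r : ℝ) ≤ ε * (q.choose (k - 2) : ℝ) := by
  obtain ⟨l, rfl⟩ : ∃ l, k = l + 4 := ⟨k - 4, by omega⟩
  have h1 : (q + 1).choose r ≤ 2 * q.choose (l + 1) := by
    refine (choose_mono_of_le_half (s := l + 1) (by omega) (by omega)).trans ?_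
    have h2 := Nat.choose_succ_succ q l
    have h3 := choose_mono_of_le_half (m := q) (r := l) (s := l + 1) (by omega) (by omega)
    simp only [Nat.succ_eq_add_one] at h2
    omega
  have h2 := Nat.choose_succ_right_eq q (l + 1)
  have h2' : (q.choose (l + 2) : ℝ) * (l + 2) = q.choose (l + 1) * (q - (l + 1)) := by
    have := congrArg (Nat.cast : ℕ → ℝ) h2
    rw [Nat.cast_mul, Nat.cast_mul, Nat.cast_sub (by omega)] at this
    push_cast at this
    convert this using 2
    ring
  have h1' : ((q + 1).choose r : ℝ) ≤ 2 * q.choose (l + 1) := by exact_mod_cast h1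
  have hq' : (n : ℝ) ≤ q + 3 + (l + 4) := by exact_mod_cast hq
  push_cast at hn
  have h3 : 12 * ((l : ℝ) + 2) ≤ ε * (q - (l + 1)) := by
    have h4 : ε * n ≤ ε * (q + 3 + (l + 4)) := mul_le_mul_of_nonneg_left hq' hε0.le
    have h5 : ε * (2 * l + 8) ≤ 2 * l + 8 := by
      have : (0 : ℝ) ≤ 2 * l + 8 := by positivity
      nlinarith
    have h6 : (0 : ℝ) ≤ l := by positivity
    nlinarith
  refine le_of_mul_le_mul_right ?_ (show (0 : ℝ) < l + 2 by positivity)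
  rw [show l + 4 - 2 = l + 2 by omega, mul_assoc ε, h2']
  calc 6 * ((q + 1).choose r : ℝ) * (l + 2) ≤ 6 * (2 * q.choose (l + 1)) * (l + 2) := by gcongr
    _ = q.choose (l + 1) * (12 * (l + 2)) := by ring
    _ ≤ q.choose (l + 1) * (ε * (q - (l + 1))) := mul_le_mul_of_nonneg_left h3 (by positivity)
    _ = _ := by ring

/-- Members that contain at most one point of a triple are outweighed by the missing members that
contain exactly two of its points. -/
theorem six_mul_card_traceClass_le {ε : ℝ} (hε : ε ≤ 1) (hε0 : 0 < ε) {n k : ℕ} (hk : 3 ≤ k)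
    (hn : 42 * (k : ℝ) ≤ ε * n) (hkn : 42 * k ≤ n) {F : Finset (Finset (Fin n))}
    (hF : (F : Set (Finset (Fin n))).Sized k) (hI : (F : Set (Finset (Fin n))).Intersecting)
    {T U U' : Finset (Fin n)} (hT : T.card = 3) (hU : U.card = 2) (hU' : U'.card ≤ 1)
    (hUU' : Disjoint U U') (h5 : (traceClass F T U').card ≤ 5 * (n - 3).choose (k - 3)) :
    6 * ((traceClass F T U').card : ℝ) ≤
      ε * ((n - 3).choose (k - 2) - (traceClass F T U).card) := by
  set R := (traceClass F T U').card with hR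
  set A := (traceClass F T U).card with hA
  rcases Nat.eq_zero_or_pos R with h0 | hpos
  · have h1 := card_traceClass_le hF T U
    rw [hT, hU, ← hA] at h1
    have h2 : (A : ℝ) ≤ (n - 3).choose (k - 2) := by exact_mod_cast h1
    rw [h0, Nat.cast_zero, mul_zero]
    exact mul_nonneg hε0.le (by linarith)
  -- Kruskal–Katona applies at the least such `t`, while minimality bounds `R` above by the binomial
  -- at `t - 1`.
  have hex : ∃ t, (n - 3 - t).choose (k - U'.card - t) ≤ R :=
    ⟨k - U'.card, by rw [Nat.sub_self, Nat.choose_zero_right]; exact hpos⟩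
  have hmin := fun t => Nat.find_min hex (m := t)
  have hspec := Nat.find_spec hex
  have htb : Nat.find hex ≤ k - U'.card :=
    Nat.find_min' hex (by rw [Nat.sub_self, Nat.choose_zero_right]; exact hpos)
  generalize Nat.find hex = t at hmin hspec htb
  have hkk := card_traceClass_add_choose_le hF hI (T := T) (t := t) hUU' (by omega) (by omega)
    (by rwa [hT])
  rw [hT, hU, ← hA] at hkk
  have hkk' : (A : ℝ) + (n - 3 - t).choose (k - 2) ≤ (n - 3).choose (k - 2) := by
    exact_mod_cast hkk
  have hgoal : 6 * (R : ℝ) ≤ ε * (n - 3 - t).choose (k - 2) := by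
    -- For `t ≤ 3` the binomial at `t` is at least M - 3N, so 6R ≤ 30N ≤ 41N - 3N suffices; for
    -- larger `t` minimality does.
    by_cases ht : t ≤ 3
    · have h1 := choose_le_choose_sub_three_add (m := n - 3) (r := k - 3) (by omega)
      have h2 := Nat.choose_le_choose (k - 3) (show n - 3 - 1 ≤ n - 3 by omega)
      have h3 := Nat.choose_le_choose (k - 2) (show n - 3 - 3 ≤ n - 3 - t by omega)
      rw [show k - 3 + 1 = k - 2 by omega] at h1
      have h4 : (n - 3).choose (k - 2) ≤
          (n - 3 - t).choose (k - 2) + 3 * (n - 3).choose (k - 3) := by omega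
      have h4' : ((n - 3).choose (k - 2) : ℝ) ≤
          (n - 3 - t).choose (k - 2) + 3 * (n - 3).choose (k - 3) := by exact_mod_cast h4
      have h5' : (R : ℝ) ≤ 5 * (n - 3).choose (k - 3) := by exact_mod_cast h5
      have h6 := fortyOne_mul_choose_le hε hk hn hkn
      have h7 : (0 : ℝ) ≤ (n - 3).choose (k - 3) := by positivity
      nlinarith
    · have h1 := hmin (t - 1) (by omega)
      have h2 := six_mul_choose_le hε hε0 (q := n - 3 - t) (r := k - U'.card - (t - 1)) (by omega)
        hn hkn (by omega) (by omega)
      rw [show n - 3 - t + 1 = n - 3 - (t - 1) by omega] at h2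
      have h3 : (R : ℝ) ≤ (n - 3 - (t - 1)).choose (k - U'.card - (t - 1)) := by
        exact_mod_cast (not_le.1 h1).le
      linarith
  nlinarith

/-! ### Degrees, diversity and triangle families. -/

theorem card_memberSubfamily {n : ℕ} (F : Finset (Finset (Fin n))) (x : Fin n) :
    (F.memberSubfamily x).card = (F.filter fun S => x ∈ S).card := by
  rw [Finset.memberSubfamily]
  exact Finset.card_image_of_injOn fun S hS S' hS' h =>
    Finset.erase_injOn' x (Finset.mem_filter.1 hS).2 (Finset.mem_filter.1 hS').2 h

theorem card_filter_mem_le_maxDegree {n : ℕ} (F : Finset (Finset (Fin n))) (x : Fin n) :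
    (F.filter fun S => x ∈ S).card ≤ maxDegree F := by
  rw [← card_memberSubfamily]
  exact Finset.le_sup (f := fun x => (F.memberSubfamily x).card) (Finset.mem_univ x)

theorem card_avoid_singleton_add {n : ℕ} (F : Finset (Finset (Fin n))) (x : Fin n) :
    (avoid F {x}).card + (F.filter fun S => x ∈ S).card = F.card := by
  rw [add_comm, ← Finset.card_filter_add_card_filter_not (s := F) (fun S => x ∈ S), avoid]
  simp only [Finset.disjoint_singleton_right]

/-- The `k`-sets that contain exactly two elements of `T`. -/
def triangleFamily {n : ℕ} (T : Finset (Fin n)) (k : ℕ) : Finset (Finset (Fin n)) :=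
  (Finset.powersetCard k Finset.univ).filter fun S => (S ∩ T).card = 2

theorem mem_triangleFamily {n k : ℕ} {T S : Finset (Fin n)} :
    S ∈ triangleFamily T k ↔ S.card = k ∧ (S ∩ T).card = 2 := by
  simp [triangleFamily, Finset.mem_powersetCard]

theorem card_traceClass_triangleFamily {n k : ℕ} (hk : 2 ≤ k) {T U : Finset (Fin n)} (hU : U ⊆ T)
    (hU2 : U.card = 2) :
    (traceClass (triangleFamily T k) T U).card = (n - T.card).choose (k - 2) := by
  have hV : Tᶜ.card = n - T.card := by rw [Finset.card_compl, Fintype.card_fin]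
  rw [← card_image_sdiff_traceClass, ← hV, ← Finset.card_powersetCard]
  congr 1
  ext X
  rw [Finset.mem_image, Finset.mem_powersetCard]
  constructor
  · rintro ⟨S, hS, rfl⟩
    rw [mem_traceClass, mem_triangleFamily] at hS
    have := Finset.card_sdiff_add_card_inter S T
    refine ⟨fun x hx => ?_, by omega⟩
    simpa using (Finset.mem_sdiff.1 hx).2
  · rintro ⟨hX, hXc⟩
    have hXT : Disjoint X T := Finset.subset_compl_iff_disjoint_right.1 hX
    have hXU : Disjoint X U := hXT.mono_right hU
    have h1 : (X ∪ U) ∩ T = U := by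
      rw [Finset.union_inter_distrib_right, Finset.disjoint_iff_inter_eq_empty.1 hXT,
        Finset.empty_union, Finset.inter_eq_left.2 hU]
    refine ⟨X ∪ U, mem_traceClass.2 ⟨mem_triangleFamily.2 ⟨?_, ?_⟩, h1⟩, ?_⟩
    · rw [Finset.card_union_of_disjoint hXU]
      omega
    · rw [h1, hU2]
    · rw [Finset.union_sdiff_distrib, Finset.sdiff_eq_self_of_disjoint hXT,
        Finset.sdiff_eq_empty_iff_subset.2 hU, Finset.union_empty]

theorem card_triangleFamily {n k : ℕ} (hk : 2 ≤ k) {T : Finset (Fin n)} (hT : T.card = 3) :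
    (triangleFamily T k).card = 3 * (n - 3).choose (k - 2) := by
  rw [Finset.card_eq_sum_card_fiberwise (f := fun S => S ∩ T) (t := Finset.powersetCard 2 T)]
  · rw [Finset.sum_congr rfl (g := fun _ => (n - 3).choose (k - 2)), Finset.sum_const,
      Finset.card_powersetCard, hT]
    · rfl
    · intro U hU
      rw [Finset.mem_powersetCard] at hU
      rw [← hT]
      exact card_traceClass_triangleFamily hk hU.1 hU.2
  · intro S hS
    exact Finset.mem_coe.2 (Finset.mem_powersetCard.2
      ⟨Finset.inter_subset_right, (mem_triangleFamily.1 hS).2⟩)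

theorem sum_card_filter_mem {n : ℕ} (F : Finset (Finset (Fin n))) (T : Finset (Fin n)) :
    ∑ t ∈ T, (F.filter fun S => t ∈ S).card = ∑ S ∈ F, (S ∩ T).card := by
  simp only [Finset.card_filter]
  rw [Finset.sum_comm]
  refine Finset.sum_congr rfl fun S _ => ?_
  rw [← Finset.card_filter, Finset.filter_mem_eq_inter, Finset.inter_comm]

theorem sum_card_inter_le {n : ℕ} (F : Finset (Finset (Fin n))) {T : Finset (Fin n)}
    (hT : T.card = 3) : ∑ S ∈ F, (S ∩ T).card ≤ 3 * maxDegree F := by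
  rw [← sum_card_filter_mem, ← hT, ← smul_eq_mul]
  exact Finset.sum_le_card_nsmul _ _ _ fun t _ => card_filter_mem_le_maxDegree F t

/-- A point of `T` is missed by one of the three trace classes, and a point outside has degree at
most 3N, which is less; averaging over `T` gives the lower bound. -/
theorem maxDegree_triangleFamily {n k : ℕ} (hk : 3 ≤ k) (hn : 42 * k ≤ n) {T : Finset (Fin n)}
    (hT : T.card = 3) : maxDegree (triangleFamily T k) = 2 * (n - 3).choose (k - 2) := by
  have hcard := card_triangleFamily (by omega : 2 ≤ k) hT (n := n)
  have hsz : (triangleFamily T k : Set (Finset (Fin n))).Sized k := fun S hS =>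
    (mem_triangleFamily.1 (Finset.mem_coe.1 hS)).1
  apply le_antisymm
  · refine Finset.sup_le fun x _ => ?_
    rw [card_memberSubfamily]
    by_cases hx : x ∈ T
    · have h1 := card_avoid_singleton_add (triangleFamily T k) x
      have hc := Finset.card_erase_of_mem hx
      have h2 := card_traceClass_triangleFamily (by omega : 2 ≤ k) (Finset.erase_subset x T)
        (by omega)
      have h3 : (traceClass (triangleFamily T k) T (T.erase x)).card ≤
          (avoid (triangleFamily T k) {x}).card := by
        refine Finset.card_le_card fun S hS => ?_
        rw [mem_traceClass] at hS
        rw [mem_avoid, Finset.disjoint_singleton_right]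
        refine ⟨hS.1, fun hxS => ?_⟩
        exact Finset.notMem_erase x T (hS.2 ▸ Finset.mem_inter.2 ⟨hxS, hx⟩)
      rw [hT] at h2
      omega
    · have h1 : ((triangleFamily T k).filter fun S => x ∈ S).card ≤
          3 * (n - 3).choose (k - 3) := by
        calc _ ≤ ((Finset.powersetCard 2 T).biUnion fun U =>
              (triangleFamily T k).filter fun S => insert x U ⊆ S).card := by
              refine Finset.card_le_card fun S hS => ?_
              rw [Finset.mem_filter] at hS
              refine Finset.mem_biUnion.2 ⟨S ∩ T, Finset.mem_powersetCard.2
                ⟨Finset.inter_subset_right, (mem_triangleFamily.1 hS.1).2⟩,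
                Finset.mem_filter.2 ⟨hS.1, ?_⟩⟩
              exact Finset.insert_subset hS.2 Finset.inter_subset_left
          _ ≤ ∑ U ∈ Finset.powersetCard 2 T, (n - 3).choose (k - 3) := by
              refine Finset.card_biUnion_le.trans (Finset.sum_le_sum fun U hU => ?_)
              rw [Finset.mem_powersetCard] at hU
              have := card_filter_superset_le hsz (insert x U)
              rwa [Finset.card_insert_of_notMem fun h => hx (hU.1 h), hU.2] at this
          _ = _ := by
              rw [Finset.sum_const, Finset.card_powersetCard, hT]
              rfl
      have h2 := fortyOne_mul_choose_le le_rfl hk (n := n) (by rw [one_mul]; exact_mod_cast hn) hn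
      rw [one_mul] at h2
      have h3 : 41 * (n - 3).choose (k - 3) ≤ (n - 3).choose (k - 2) := by exact_mod_cast h2
      omega
  · have h1 := sum_card_inter_le (triangleFamily T k) hT
    rw [Finset.sum_congr rfl fun S hS => (mem_triangleFamily.1 hS).2, Finset.sum_const,
      smul_eq_mul, hcard] at h1
    omega

theorem cDiversity_triangleFamily (C : ℝ) {n k : ℕ} (hk : 3 ≤ k) (hn : 42 * k ≤ n)
    {T : Finset (Fin n)} (hT : T.card = 3) :
    cDiversity C (triangleFamily T k) = (3 - 2 * C) * ((n - 3).choose (k - 2) : ℝ) := by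
  rw [cDiversity, maxDegree_triangleFamily hk hn hT, card_triangleFamily (by omega) hT]
  push_cast
  ring

/-- The members of a family, weighted by the size of their trace on a triple. -/
theorem exists_card_trace_counts {n : ℕ} (F : Finset (Finset (Fin n))) {T : Finset (Fin n)}
    (hT : T.card = 3) : ∃ r : ℕ → ℕ, (∀ l, r l = (F.filter fun S => (S ∩ T).card = l).card) ∧
      F.card = r 0 + r 1 + r 2 + r 3 ∧ r 1 + 2 * r 2 + 3 * r 3 ≤ 3 * maxDegree F := by
  have hmap : ∀ S ∈ F, (S ∩ T).card ∈ Finset.range 4 := fun S _ => by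
    have := Finset.card_le_card (Finset.inter_subset_right : S ∩ T ⊆ T)
    rw [Finset.mem_range]
    omega
  refine ⟨fun l => (F.filter fun S => (S ∩ T).card = l).card, fun l => rfl, ?_, ?_⟩
  · rw [Finset.card_eq_sum_card_fiberwise hmap]
    simp [Finset.sum_range_succ]
  · refine le_trans (le_of_eq ?_) (sum_card_inter_le F hT)
    rw [← Finset.sum_fiberwise_of_maps_to hmap]
    have h : ∀ l, ∑ S ∈ F.filter (fun S => (S ∩ T).card = l), (S ∩ T).card =
        (F.filter fun S => (S ∩ T).card = l).card * l := fun l => by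
      rw [Finset.sum_congr rfl fun S hS => (Finset.mem_filter.1 hS).2, Finset.sum_const,
        smul_eq_mul]
    simp only [h, Finset.sum_range_succ, Finset.sum_range_zero]
    ring

theorem eq_triangleFamily_of_le_cDiversity {C : ℝ} (hC₁ : 1 < C) (hC₂ : C < 3 / 2) {n k : ℕ}
    (hk : 3 ≤ k) (hn : 42 * (k : ℝ) ≤ (3 - 2 * C) * n) (hkn : 42 * k ≤ n)
    {F : Finset (Finset (Fin n))} (hF : (F : Set (Finset (Fin n))).Sized k)
    (hI : (F : Set (Finset (Fin n))).Intersecting) {x y z : Fin n} (hxy : x ≠ y) (hxz : x ≠ z)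
    (hyz : y ≠ z) (h1 : (avoid F {x, y}).card ≤ 5 * (n - 3).choose (k - 3))
    (h2 : (avoid F {x, z}).card ≤ 5 * (n - 3).choose (k - 3))
    (h3 : (avoid F {y, z}).card ≤ 5 * (n - 3).choose (k - 3))
    (hdiv : (3 - 2 * C) * ((n - 3).choose (k - 2) : ℝ) ≤ cDiversity C F) :
    F = triangleFamily {x, y, z} k := by
  set T : Finset (Fin n) := {x, y, z} with hTdef
  have hT : T.card = 3 := Finset.card_eq_three.2 ⟨x, y, z, hxy, hxz, hyz, rfl⟩
  set ε := 3 - 2 * C with hε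
  have hε1 : ε ≤ 1 := by linarith
  have hε0 : 0 < ε := by linarith
  have hsub : ∀ u v : Fin n, ∀ U : Finset (Fin n), u ∈ T → v ∈ T → u ∉ U → v ∉ U →
      (traceClass F T U).card ≤ (avoid F {u, v}).card := by
    intro u v U hu hv hu' hv'
    refine Finset.card_le_card fun S hS => ?_
    rw [mem_traceClass] at hS
    rw [mem_avoid, Finset.disjoint_insert_right, Finset.disjoint_singleton_right]
    exact ⟨hS.1, fun h => hu' (hS.2 ▸ Finset.mem_inter.2 ⟨h, hu⟩),
      fun h => hv' (hS.2 ▸ Finset.mem_inter.2 ⟨h, hv⟩)⟩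
  have hx : x ∈ T := by simp [hTdef]
  have hy : y ∈ T := by simp [hTdef]
  have hz : z ∈ T := by simp [hTdef]
  have b0 := (hsub x y ∅ hx hy (by simp) (by simp)).trans h1
  have key : ∀ u v U', u ≠ v → U'.card ≤ 1 → u ∉ U' → v ∉ U' →
      (traceClass F T U').card ≤ 5 * (n - 3).choose (k - 3) →
      6 * ((traceClass F T U').card : ℝ) ≤
        ε * ((n - 3).choose (k - 2) - (traceClass F T {u, v}).card) := by
    intro u v U' huv hU' hu hv hb
    exact six_mul_card_traceClass_le hε1 hε0 hk hn hkn hF hI hT (Finset.card_pair huv) hU'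
      (by simp [hu, hv]) hb
  have kz := key x y {z} hxy (by simp) (by simpa using hxz) (by simpa using hyz)
    ((hsub x y _ hx hy (by simpa using hxz) (by simpa using hyz)).trans h1)
  have ky := key x z {y} hxz (by simp) (by simpa using hxy) (by simpa using hyz.symm)
    ((hsub x z _ hx hz (by simpa using hxy) (by simpa using hyz.symm)).trans h2)
  have kx := key y z {x} hyz (by simp) (by simpa using hxy.symm) (by simpa using hxz.symm)
    ((hsub y z _ hy hz (by simpa using hxy.symm) (by simpa using hxz.symm)).trans h3)
  have k1 := key x y ∅ hxy (by simp) (by simp) (by simp) b0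
  have k2 := key x z ∅ hxz (by simp) (by simp) (by simp) b0
  have k3 := key y z ∅ hyz (by simp) (by simp) (by simp) b0
  obtain ⟨r, hr, hcard, hdeg⟩ := exists_card_trace_counts F hT
  have hr0 : r 0 ≤ (traceClass F T ∅).card := by
    rw [hr]
    refine Finset.card_le_card fun S hS => ?_
    rw [Finset.mem_filter, Finset.card_eq_zero] at hS
    exact mem_traceClass.2 hS
  have hr1 : r 1 ≤ (traceClass F T {x}).card + (traceClass F T {y}).card +
      (traceClass F T {z}).card := by
    rw [hr]
    refine (Finset.card_le_card (t := (traceClass F T {x} ∪ traceClass F T {y}) ∪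
      traceClass F T {z}) fun S hS => ?_).trans ((Finset.card_union_le _ _).trans
      (Nat.add_le_add_right (Finset.card_union_le _ _) _))
    rw [Finset.mem_filter, Finset.card_eq_one] at hS
    obtain ⟨hS, a, ha⟩ := hS
    have haT : a ∈ T := Finset.mem_of_mem_inter_right (ha ▸ Finset.mem_singleton_self a)
    simp only [hTdef, Finset.mem_insert, Finset.mem_singleton] at haT
    simp only [Finset.mem_union, mem_traceClass]
    rcases haT with rfl | rfl | rfl <;> simp [hS, ha]
  have hr2 : r 2 ≤ (traceClass F T {x, y}).card + (traceClass F T {x, z}).card +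
      (traceClass F T {y, z}).card := by
    rw [hr]
    refine (Finset.card_le_card (t := (traceClass F T {x, y} ∪ traceClass F T {x, z}) ∪
      traceClass F T {y, z}) fun S hS => ?_).trans ((Finset.card_union_le _ _).trans
      (Nat.add_le_add_right (Finset.card_union_le _ _) _))
    rw [Finset.mem_filter, Finset.card_eq_two] at hS
    obtain ⟨hS, a, b, hab, ha⟩ := hS
    have haT : a ∈ T := Finset.mem_of_mem_inter_right (ha ▸ Finset.mem_insert_self a {b})
    have hbT : b ∈ T := Finset.mem_of_mem_inter_right
      (ha ▸ Finset.mem_insert_of_mem (Finset.mem_singleton_self b))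
    simp only [hTdef, Finset.mem_insert, Finset.mem_singleton] at haT hbT
    simp only [Finset.mem_union, mem_traceClass]
    rcases haT with rfl | rfl | rfl <;> rcases hbT with rfl | rfl | rfl <;>
      first
      | exact absurd rfl hab
      | (simp [hS, ha]; done)
      | (rw [Finset.pair_comm] at ha; simp [hS, ha])
  generalize (traceClass F T ∅).card = t0 at *
  generalize (traceClass F T {x}).card = tx at *
  generalize (traceClass F T {y}).card = ty at *
  generalize (traceClass F T {z}).card = tz at *
  generalize (traceClass F T {x, y}).card = txy at *
  generalize (traceClass F T {x, z}).card = txz at *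
  generalize (traceClass F T {y, z}).card = tyz at *
  have hr0' : (r 0 : ℝ) ≤ t0 := by exact_mod_cast hr0
  have hr1' : (r 1 : ℝ) ≤ tx + ty + tz := by exact_mod_cast hr1
  have hr2' : (r 2 : ℝ) ≤ txy + txz + tyz := by exact_mod_cast hr2
  have hcard' : (F.card : ℝ) = r 0 + r 1 + r 2 + r 3 := by exact_mod_cast hcard
  have hdeg' : (r 1 : ℝ) + 2 * r 2 + 3 * r 3 ≤ 3 * maxDegree F := by exact_mod_cast hdeg
  have hr0n : (0 : ℝ) ≤ r 0 := by positivity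
  have hr1n : (0 : ℝ) ≤ r 1 := by positivity
  have hr3n : (0 : ℝ) ≤ r 3 := by positivity
  have e1 : C * ((r 1 : ℝ) + 2 * r 2 + 3 * r 3) ≤ C * (3 * maxDegree F) :=
    mul_le_mul_of_nonneg_left hdeg' (by linarith)
  have e2 : ε * (r 2 : ℝ) ≤ ε * (txy + txz + tyz) := mul_le_mul_of_nonneg_left hr2' hε0.le
  have e3 : 0 ≤ (C - 1) * (r 1 : ℝ) := mul_nonneg (by linarith) hr1n
  have e4 : 0 ≤ (C - 1) * (r 3 : ℝ) := mul_nonneg (by linarith) hr3n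
  rw [cDiversity, hcard'] at hdiv
  -- Averaging over the triple weights a trace of size l by 3 - Cl. With D = ε(3M - txy - txz -
  -- tyz), the six-fold inequalities give 18 r₀ ≤ D and 6 r₁ ≤ D, so D ≤ 3 r₀ + 2 r₁ ≤ D/2 and
  -- everything vanishes.
  have e5 : 3 * (ε * ((n - 3).choose (k - 2) : ℝ)) ≤
      3 * r 0 + 2 * r 1 + ε * r 2 - 3 * ((C - 1) * r 3) := by
    rw [hε] at hdiv ⊢
    linarith
  have z0 : (r 0 : ℝ) ≤ 0 := by linarith
  have z1 : (r 1 : ℝ) ≤ 0 := by linarith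
  have z3 : (C - 1) * (r 3 : ℝ) ≤ 0 := by linarith
  have z3' : (r 3 : ℝ) ≤ 0 := by
    by_contra! hpos
    exact absurd z3 (not_le.2 (mul_pos (by linarith) hpos))
  have z2 : 3 * ((n - 3).choose (k - 2) : ℝ) ≤ r 2 := by
    refine le_of_mul_le_mul_left ?_ hε0
    linarith
  have n0 : r 0 = 0 := by exact_mod_cast le_antisymm z0 hr0n
  have n1 : r 1 = 0 := by exact_mod_cast le_antisymm z1 hr1n
  have n3 : r 3 = 0 := by exact_mod_cast le_antisymm z3' hr3n
  have n2 : 3 * (n - 3).choose (k - 2) ≤ r 2 := by exact_mod_cast z2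
  refine Finset.eq_of_subset_of_card_le (fun S hS => mem_triangleFamily.2 ⟨hF hS, ?_⟩) ?_
  · have hall : (F.filter fun S => (S ∩ T).card = 2) = F :=
      Finset.eq_of_subset_of_card_le (Finset.filter_subset _ _) (by rw [← hr]; omega)
    rw [← hall] at hS
    exact (Finset.mem_filter.1 hS).2
  · rw [card_triangleFamily (by omega) hT]
    omega

/-! ### Isomorphism with the pure triangle family, and the conclusion. -/

theorem map_mem_triangleFamily_map {n k : ℕ} (σ : Equiv.Perm (Fin n)) (T S : Finset (Fin n)) :
    S.map σ.toEmbedding ∈ triangleFamily (T.map σ.toEmbedding) k ↔ S ∈ triangleFamily T k := by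
  rw [mem_triangleFamily, mem_triangleFamily, ← Finset.map_inter, Finset.card_map, Finset.card_map]

theorem familyIso_pureTriangle_iff {n k : ℕ} (hn : 3 ≤ n) (F : Finset (Finset (Fin n))) :
    FamilyIso F (pureTriangle n k) ↔ ∃ T : Finset (Fin n), T.card = 3 ∧ F = triangleFamily T k := by
  set T₀ : Finset (Fin n) := Finset.univ.filter fun i : Fin n => (i : ℕ) < 3 with hT₀
  have hpure : pureTriangle n k = triangleFamily T₀ k := rfl
  have hcard : T₀.card = 3 := by
    rw [hT₀, Fin.card_filter_val_lt]
    omega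
  rw [hpure]
  constructor
  · rintro ⟨σ, hσ⟩
    refine ⟨T₀.map σ.symm.toEmbedding, by rw [Finset.card_map, hcard], ?_⟩
    ext S
    have hback : (T₀.map σ.symm.toEmbedding).map σ.toEmbedding = T₀ := by
      ext v
      simp
    rw [hσ, ← map_mem_triangleFamily_map σ (T₀.map σ.symm.toEmbedding), hback]
  · rintro ⟨T, hT, rfl⟩
    set e := Finset.equivOfCardEq (hT.trans hcard.symm)
    have hmap : T.map (e.extendSubtype).toEmbedding = T₀ := by
      refine Finset.eq_of_subset_of_card_le (fun v hv => ?_) (by rw [Finset.card_map]; omega)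
      obtain ⟨w, hw, rfl⟩ := Finset.mem_map.1 hv
      exact e.extendSubtype_mem w hw
    refine ⟨e.extendSubtype, fun S => ?_⟩
    have := map_mem_triangleFamily_map (k := k) e.extendSubtype T S
    rw [hmap] at this
    exact this.symm

theorem exists_eq_triangleFamily_of_le_cDiversity {C : ℝ} (hC₁ : 1 < C) (hC₂ : C < 3 / 2) {n k : ℕ}
    (hk : 3 ≤ k) (hn : 42 * (k : ℝ) ≤ (3 - 2 * C) * n) (hkn : 42 * k ≤ n)
    {F : Finset (Finset (Fin n))} (hF : (F : Set (Finset (Fin n))).Sized k)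
    (hI : (F : Set (Finset (Fin n))).Intersecting)
    (hdiv : (3 - 2 * C) * ((n - 3).choose (k - 2) : ℝ) ≤ cDiversity C F) :
    ∃ T : Finset (Fin n), T.card = 3 ∧ F = triangleFamily T k := by
  have hN0 : 0 < (n - 3).choose (k - 3) := Nat.choose_pos (by omega)
  have havoid : ∀ x, 41 * (n - 3).choose (k - 3) ≤ (avoid F {x}).card := by
    intro x
    have h1 := fortyOne_mul_choose_le (by linarith) hk hn hkn
    have h2 : ((avoid F {x}).card : ℝ) + (F.filter fun S => x ∈ S).card = F.card := by
      exact_mod_cast card_avoid_singleton_add F x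
    have h3 : ((F.filter fun S => x ∈ S).card : ℝ) ≤ maxDegree F := by
      exact_mod_cast card_filter_mem_le_maxDegree F x
    have h4 : (0 : ℝ) ≤ (C - 1) * maxDegree F := mul_nonneg (by linarith) (by positivity)
    rw [cDiversity] at hdiv
    have h5 : 41 * ((n - 3).choose (k - 3) : ℝ) ≤ (avoid F {x}).card := by linarith
    exact_mod_cast h5
  have hcard : 41 * (n - 3).choose (k - 3) ≤ F.card :=
    (havoid ⟨0, by omega⟩).trans (Finset.card_le_card (avoid_subset _ _))
  obtain ⟨x, y, hxy, hxy'⟩ := exists_card_avoid_pair_lt hk hkn rfl hN0 hF hI (by omega)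
    fun x => by have := havoid x; omega
  have hx := havoid x
  have hy := havoid y
  obtain ⟨z, hzx, hzy, hz⟩ := exists_card_avoid_add_card_avoid_lt hk hkn rfl hF hI hxy hxy'
    (by omega) (by omega)
  exact ⟨{x, y, z}, Finset.card_eq_three.2 ⟨x, y, z, hxy, hzx.symm, hzy.symm, rfl⟩,
    eq_triangleFamily_of_le_cDiversity hC₁ hC₂ hk hn hkn hF hI hxy hzx.symm hzy.symm (by omega)
      (by omega) (by omega) hdiv⟩

theorem theorem1p9 (C : ℝ) (hC₁ : 1 < C) (hC₂ : C < 3 / 2) (n k : ℕ) (hk : 3 ≤ k)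
    (hn : 42 * (k : ℝ) / (3 - 2 * C) ≤ (n : ℝ)) (F : Finset (Finset (Fin n)))
    (hFk : (F : Set (Finset (Fin n))).Sized k)
    (hF : (F : Set (Finset (Fin n))).Intersecting) :
    cDiversity C F ≤ (3 - 2 * C) * ((n - 3).choose (k - 2) : ℝ) ∧
      (cDiversity C F = (3 - 2 * C) * ((n - 3).choose (k - 2) : ℝ) ↔
        FamilyIso F (pureTriangle n k)) := by
  have hε : 0 < 3 - 2 * C := by linarith
  have hn' : 42 * (k : ℝ) ≤ (3 - 2 * C) * n := by
    rwa [div_le_iff₀ hε, mul_comm (n : ℝ)] at hn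
  have hkn : 42 * k ≤ n := by
    have h1 : (3 - 2 * C) * n ≤ 1 * (n : ℝ) :=
      mul_le_mul_of_nonneg_right (by linarith) (by positivity)
    have h2 : 42 * (k : ℝ) ≤ n := by linarith
    exact_mod_cast h2
  rw [familyIso_pureTriangle_iff (by omega)]
  have hvalue : ∀ T : Finset (Fin n), T.card = 3 → F = triangleFamily T k →
      cDiversity C F = (3 - 2 * C) * ((n - 3).choose (k - 2) : ℝ) := by
    rintro T hT rfl
    exact cDiversity_triangleFamily C hk hkn hT
  refine ⟨?_, fun h => exists_eq_triangleFamily_of_le_cDiversity hC₁ hC₂ hk hn' hkn hFk hF h.ge,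
    fun ⟨T, hT, h⟩ => hvalue T hT h⟩
  -- A family beating the bound would be a triangle family, whose diversity equals the bound.
  by_contra! hlt
  obtain ⟨T, hT, h⟩ := exists_eq_triangleFamily_of_le_cDiversity hC₁ hC₂ hk hn' hkn hFk hF hlt.le
  exact absurd (hvalue T hT h) hlt.ne'
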